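/- Let $\alpha,\nu\in\mathbb{R}$ with $\alpha+\nu>-1$ and $|\nu|<\frac12$, let $$\mathbf{H}_\nu(z)=\sum_{n\ge 0}\frac{(-1)^n}{\Gamma\left(n+\frac32\right)\Gamma\left(n+\nu+\frac32\right)}\left(\frac z2\right)^{2n+\nu+1}$$ be the Struve function of the first kind, with the principal branch of the power, and put $$\mathcal{H}_\nu(z)=\alpha\,\mathbf{H}_\nu(z)+z\,\mathbf{H}_\nu'(z).$$ Let $$\kappa_1=-2\alpha^2\nu+7\alpha^2-4\alpha\nu^2+2\alpha\nu+42\alpha-2\nu^3-5\nu^2+72\nu+135$$ and $$\begin{aligned}\kappa_2={}&-4\alpha^3\nu^2-96\alpha^3\nu+145\alpha^3-12\alpha^2\nu^3-324\alpha^2\nu^2-429\alpha^2\nu+1305\alpha^2\\&-12\alpha\nu^4-360\alpha\nu^3-1689\alpha\nu^2+1170\alpha\nu+6291\alpha\\&-4\nu^5-132\nu^4-1115\nu^3+621\nu^2+12339\nu+14931.\end{aligned}$$ Then $\kappa_1>0$ and $\kappa_2>0$, the function $\mathcal{H}_\nu$ has a smallest positive zero $\zeta_{\nu,1}$, and it satisfies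 the lower bounds $$\zeta_{\nu,1}^2>\frac{3(2\nu+3)(\alpha+\nu+1)}{\alpha+\nu+3},$$ $$\zeta_{\nu,1}^2>\frac{3(2\nu+3)(\alpha+\nu+1)\sqrt{5(2\nu+5)}}{\sqrt{\kappa_1}},$$ $$\zeta_{\nu,1}^2>\frac{3(2\nu+3)(\alpha+\nu+1)\sqrt[3]{35(2\nu+5)(2\nu+7)}}{\sqrt[3]{\kappa_2}}$$ and the upper bounds $$\zeta_{\nu,1}^2<\frac{15(2\nu+3)(2\nu+5)(\alpha+\nu+1)(\alpha+\nu+3)}{\kappa_1},$$ $$\zeta_{\nu,1}^2<\frac{21(2\nu+3)(2\nu+7)(\alpha+\nu+1)\kappa_1}{\kappa_2}.$$ -/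

import Mathlib

/-- The Struve function of the first kind
`𝐇_ν(z) = ∑_{n ≥ 0} (-1)^n / (Γ(n + 3/2) Γ(n + ν + 3/2)) (z/2)^(2n + ν + 1)`,
with the principal branch of the power. -/
noncomputable def struveH (ν z : ℂ) : ℂ :=
  ∑' n : ℕ, (-1 : ℂ) ^ n / (Complex.Gamma ((n : ℂ) + 3 / 2) * Complex.Gamma ((n : ℂ) + ν + 3 / 2)) *
    (z / 2) ^ (2 * (n : ℂ) + ν + 1)

/-- The linear combination `𝓗_ν(z) = α 𝐇_ν(z) + z 𝐇_ν′(z)`. -/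
noncomputable def struveComb (α ν z : ℂ) : ℂ :=
  α * struveH ν z + z * deriv (struveH ν) z

/-- The polynomial `κ₁` in `α` and `ν`. -/
def kappaOne (α ν : ℝ) : ℝ :=
  -2 * α ^ 2 * ν + 7 * α ^ 2 - 4 * α * ν ^ 2 + 2 * α * ν + 42 * α
    - 2 * ν ^ 3 - 5 * ν ^ 2 + 72 * ν + 135

/-- The polynomial `κ₂` in `α` and `ν`. -/
def kappaTwo (α ν : ℝ) : ℝ :=
  -4 * α ^ 3 * ν ^ 2 - 96 * α ^ 3 * ν + 145 * α ^ 3 - 12 * α ^ 2 * ν ^ 3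
    - 324 * α ^ 2 * ν ^ 2 - 429 * α ^ 2 * ν + 1305 * α ^ 2 - 12 * α * ν ^ 4
    - 360 * α * ν ^ 3 - 1689 * α * ν ^ 2 + 1170 * α * ν + 6291 * α
    - 4 * ν ^ 5 - 132 * ν ^ 4 - 1115 * ν ^ 3 + 621 * ν ^ 2 + 12339 * ν + 14931

/-!
The proof makes the Euler-Rayleigh method rigorous without a Hadamard factorization. For `|ν| < 1/2`
the Struve function is, up to a power and a constant, the finite sine transform
`∫ t in 0..1, φ t * sin (z t)` of the increasing weight `φ t = (1 - t ^ 2) ^ (ν - 1/2)`. Hence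
`struveComb α ν z` is `z ^ (ν + 1)` times a constant times a power series `f` in `x = z ^ 2`, whose
coefficients are `(a + 2 j)` times those of the transform, with `a = α + ν + 1 > 0`.

Concentrating `φ` at equally spaced nodes turns the transform into a sine polynomial with increasing
weights, and by Pólya's theorem such a sine polynomial, in the variable `2 - 2 cos θ`, has only
positive real zeros (`im_eq_zero_and_re_pos_of_aeval_sum_sinQuot`). The operation
`p ↦ a p + 2 x p'` preserves this property
(`im_eq_zero_and_re_pos_of_aeval_add_derivative`). So `f`, normalized by `f 0 = 1`, is a locally
uniform limit of polynomials `∏ (1 - y x)` with all `y > 0`, and the power sums of the `y` converge to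
polynomials `σ₁, σ₂, σ₃` in the first three coefficients of `f` (`exists_prodOneSub_tendsto`).

For finite products, `y_max ^ k ≤ ∑ y ^ k` and `∑ y ^ (k + 1) ≤ y_max * ∑ y ^ k` are evident. In the
limit they become the bounds for the least positive zero of `f`, and they stay strict because `f` has
a second positive zero at a definite distance: the sine transform is positive at `π`, negative at
`2 π` and positive at `3 π`, so by Rolle's argument `f` takes a negative and then a positive value
(`exists_sign_change`), which traps one more `y` of every late approximant
(`inv_pow_lt_of_tendsto_powerSum`, `lt_inv_mul_of_tendsto_powerSum`). Positivity of `κ₁` and `κ₂` is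
positivity of `σ₂` and `σ₃`.
-/

section

open Polynomial Filter Topology MeasureTheory

/-! ### Power sums and products `∏ (1 - y X)` -/

/-- The polynomial `∏ (1 - y X)` over a multiset of reals `y`, the reciprocals of its roots. -/
noncomputable def prodOneSub (Y : Multiset ℝ) : ℝ[X] :=
  (Y.map fun y => 1 - C y * X).prod

/-- The power sum `∑ y ^ k` over a multiset of reals. -/
noncomputable def powerSum (Y : Multiset ℝ) (k : ℕ) : ℝ :=
  (Y.map fun y => y ^ k).sum

theorem prodOneSub_zero : prodOneSub 0 = 1 := by simp [prodOneSub]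

theorem prodOneSub_cons (y : ℝ) (Y : Multiset ℝ) :
    prodOneSub (y ::ₘ Y) = (1 - C y * X) * prodOneSub Y := by simp [prodOneSub]

theorem powerSum_cons (y : ℝ) (Y : Multiset ℝ) (k : ℕ) :
    powerSum (y ::ₘ Y) k = y ^ k + powerSum Y k := by simp [powerSum]

theorem eval_prodOneSub (Y : Multiset ℝ) (x : ℝ) :
    (prodOneSub Y).eval x = (Y.map fun y => 1 - y * x).prod := by
  simp [prodOneSub, eval_multiset_prod, Multiset.map_map]

theorem coeff_prodOneSub_cons_succ (y : ℝ) (Y : Multiset ℝ) (n : ℕ) :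
    (prodOneSub (y ::ₘ Y)).coeff (n + 1)
      = (prodOneSub Y).coeff (n + 1) - y * (prodOneSub Y).coeff n := by
  rw [prodOneSub_cons, sub_mul, one_mul, mul_assoc, coeff_sub, coeff_C_mul, coeff_X_mul]

theorem coeff_zero_prodOneSub (Y : Multiset ℝ) : (prodOneSub Y).coeff 0 = 1 := by
  rw [coeff_zero_eq_eval_zero, eval_prodOneSub]; simp

theorem powerSum_one (Y : Multiset ℝ) : powerSum Y 1 = -(prodOneSub Y).coeff 1 := by
  induction Y using Multiset.induction_on with
  | empty => simp [powerSum, prodOneSub_zero, coeff_one]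
  | cons y Y ih =>
    rw [powerSum_cons, coeff_prodOneSub_cons_succ, coeff_zero_prodOneSub, ih]; ring

theorem powerSum_two (Y : Multiset ℝ) :
    powerSum Y 2 = (prodOneSub Y).coeff 1 ^ 2 - 2 * (prodOneSub Y).coeff 2 := by
  induction Y using Multiset.induction_on with
  | empty => simp [powerSum, prodOneSub_zero, coeff_one]
  | cons y Y ih =>
    rw [powerSum_cons, coeff_prodOneSub_cons_succ, coeff_prodOneSub_cons_succ,
      coeff_zero_prodOneSub, ih]; ring

theorem powerSum_three (Y : Multiset ℝ) :
    powerSum Y 3 = -(prodOneSub Y).coeff 1 ^ 3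
      + 3 * (prodOneSub Y).coeff 1 * (prodOneSub Y).coeff 2 - 3 * (prodOneSub Y).coeff 3 := by
  induction Y using Multiset.induction_on with
  | empty => simp [powerSum, prodOneSub_zero, coeff_one]
  | cons y Y ih =>
    rw [powerSum_cons, coeff_prodOneSub_cons_succ, coeff_prodOneSub_cons_succ,
      coeff_prodOneSub_cons_succ, coeff_zero_prodOneSub, ih]; ring

theorem add_pow_le_powerSum {Y : Multiset ℝ} (hY : ∀ y ∈ Y, 0 < y) {u v : ℝ} (hu : u ∈ Y)
    (hv : v ∈ Y) (huv : u ≠ v) (k : ℕ) : u ^ k + v ^ k ≤ powerSum Y k := by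
  obtain ⟨Z, rfl⟩ := Multiset.exists_cons_of_mem hu
  have hvZ : v ∈ Z := by
    rcases Multiset.mem_cons.1 hv with h | h
    · exact absurd h.symm huv
    · exact h
  obtain ⟨W, rfl⟩ := Multiset.exists_cons_of_mem hvZ
  rw [powerSum_cons, powerSum_cons]
  have : 0 ≤ powerSum W k := by
    refine Multiset.sum_nonneg fun z hz => ?_
    obtain ⟨y, hy, rfl⟩ := Multiset.mem_map.1 hz
    exact pow_nonneg (hY y (by simp [hy])).le k
  linarith

theorem pow_mul_sub_le_powerSum {Y : Multiset ℝ} (hY : ∀ y ∈ Y, 0 < y) {C v : ℝ}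
    (hC : ∀ y ∈ Y, y ≤ C) (hv : v ∈ Y) (k : ℕ) :
    v ^ k * (C - v) ≤ C * powerSum Y k - powerSum Y (k + 1) := by
  obtain ⟨W, rfl⟩ := Multiset.exists_cons_of_mem hv
  rw [powerSum_cons, powerSum_cons]
  have : powerSum W (k + 1) ≤ C * powerSum W k := by
    rw [powerSum, powerSum, ← Multiset.sum_map_mul_left]
    refine Multiset.sum_map_le_sum_map _ _ fun y hy => ?_
    rw [pow_succ, mul_comm]
    exact mul_le_mul_of_nonneg_right (hC y (by simp [hy]))
      (pow_nonneg (hY y (by simp [hy])).le k)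
  rw [pow_succ]
  nlinarith

/-- If every factor `1 - y x` is at least `ε`, the product is bounded below by the first power
sum only, because `1 - t ≥ exp (-t / ε)` for `0 ≤ t ≤ 1 - ε`. -/
theorem exp_le_eval_prodOneSub {Y : Multiset ℝ} (hY : ∀ y ∈ Y, 0 < y) {x ε : ℝ} (hx : 0 < x)
    (hε : 0 < ε) (h : ∀ y ∈ Y, y * x ≤ 1 - ε) :
    Real.exp (-(x * powerSum Y 1 / ε)) ≤ (prodOneSub Y).eval x := by
  rw [eval_prodOneSub]
  induction Y using Multiset.induction_on with
  | empty => simp [powerSum]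
  | cons y Y ih =>
    have ih' := ih (fun z hz => hY z (by simp [hz])) (fun z hz => h z (by simp [hz]))
    have h1 := h y (by simp)
    have h0 : 0 < y * x := mul_pos (hY y (by simp)) hx
    rw [Multiset.map_cons, Multiset.prod_cons, powerSum_cons]
    have e : -(x * (y ^ 1 + powerSum Y 1) / ε)
        = -(y * x / ε) + -(x * powerSum Y 1 / ε) := by ring
    rw [e, Real.exp_add]
    refine mul_le_mul ?_ ih' (Real.exp_pos _).le (by linarith)
    have h2 := Real.add_one_le_exp (y * x / ε)
    have h3 : 1 ≤ (1 - y * x) * (y * x / ε + 1) := by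
      have h4 : y * x ≤ (1 - y * x) * (y * x / ε) := by
        rw [mul_div_assoc', le_div_iff₀ hε]; nlinarith
      linarith
    rw [Real.exp_neg, inv_le_iff_one_le_mul₀ (Real.exp_pos _)]
    exact h3.trans (mul_le_mul_of_nonneg_left h2 (by linarith))

/-- Locally uniform convergence of polynomials whose coefficients converge under a summable
bound. -/
theorem eventually_abs_eval_sub_tsum_lt {p : ℕ → ℝ[X]} {c B : ℕ → ℝ}
    (hlim : ∀ j, Tendsto (fun n => (p n).coeff j) atTop (𝓝 (c j)))
    (hdom : ∀ᶠ n in atTop, ∀ j, |(p n).coeff j| ≤ B j)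
    (hB : ∀ R : ℝ, Summable fun j => B j * R ^ j) {R ε : ℝ} (hR : 0 ≤ R) (hε : 0 < ε) :
    ∀ᶠ n in atTop, ∀ x, 0 ≤ x → x ≤ R → |(p n).eval x - ∑' j, c j * x ^ j| < ε := by
  have hc : ∀ j, |c j| ≤ B j := fun j =>
    le_of_tendsto (hlim j).abs (hdom.mono fun n hn => hn j)
  have hT : Tendsto (fun n => ∑' j, |(p n).coeff j - c j| * R ^ j) atTop (𝓝 0) := by
    have := tendsto_tsum_of_dominated_convergence (𝓕 := atTop)
      (f := fun n j => |(p n).coeff j - c j| * R ^ j) (g := fun _ => (0 : ℝ))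
      (bound := fun j => 2 * (B j * R ^ j)) ((hB R).mul_left 2)
      (fun j => by
        have h1 : Tendsto (fun n => |(p n).coeff j - c j|) atTop (𝓝 0) := by
          simpa using ((hlim j).sub_const (c j)).abs
        simpa using h1.mul_const (R ^ j))
      (hdom.mono fun n hn j => by
        rw [Real.norm_of_nonneg (by positivity), ← mul_assoc]
        refine mul_le_mul_of_nonneg_right ?_ (by positivity)
        have := abs_sub ((p n).coeff j) (c j)
        linarith [hn j, hc j])
    simpa using this
  filter_upwards [hdom, hT.eventually (gt_mem_nhds hε)] with n hn hlt x hx0 hxR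
  refine lt_of_le_of_lt ?_ hlt
  have hs1 : Summable fun j => (p n).coeff j * x ^ j :=
    summable_of_ne_finset_zero (s := Finset.range ((p n).natDegree + 1)) fun j hj => by
      rw [coeff_eq_zero_of_natDegree_lt (by simpa using hj), zero_mul]
  have hs2 : Summable fun j => c j * x ^ j :=
    .of_norm_bounded (hB x) fun j => by
      rw [norm_mul, Real.norm_eq_abs, Real.norm_of_nonneg (pow_nonneg hx0 j)]
      exact mul_le_mul_of_nonneg_right (hc j) (pow_nonneg hx0 j)
  have hs3 : Summable fun j => |(p n).coeff j - c j| * R ^ j :=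
    .of_norm_bounded ((hB R).mul_left 2) fun j => by
      rw [Real.norm_of_nonneg (by positivity), ← mul_assoc]
      refine mul_le_mul_of_nonneg_right ?_ (by positivity)
      have := abs_sub ((p n).coeff j) (c j)
      linarith [hn j, hc j]
  have he : (p n).eval x = ∑' j, (p n).coeff j * x ^ j := by
    rw [eval_eq_sum_range, tsum_eq_sum]
    intro j hj
    rw [coeff_eq_zero_of_natDegree_lt (by simpa using hj), zero_mul]
  rw [he, ← hs1.tsum_sub hs2, ← Real.norm_eq_abs]
  refine tsum_of_norm_bounded hs3.hasSum fun j => ?_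
  rw [← sub_mul, norm_mul, Real.norm_eq_abs, Real.norm_of_nonneg (pow_nonneg hx0 j)]
  exact mul_le_mul_of_nonneg_left (pow_le_pow_left₀ hx0 hxR j) (abs_nonneg _)

theorem continuousOn_tsum_mul_pow {c B : ℕ → ℝ} (hc : ∀ j, |c j| ≤ B j)
    (hB : ∀ R : ℝ, Summable fun j => B j * R ^ j) (R : ℝ) :
    ContinuousOn (fun x => ∑' j, c j * x ^ j) (Set.Icc 0 R) := by
  refine continuousOn_tsum (fun j => by fun_prop) (hB R) fun j x hx => ?_
  rw [norm_mul, Real.norm_eq_abs, Real.norm_of_nonneg (pow_nonneg hx.1 j)]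
  exact mul_le_mul (hc j) (pow_le_pow_left₀ hx.1 hx.2 j) (pow_nonneg hx.1 j)
    ((abs_nonneg _).trans (hc j))

/-! ### The least zero of a limit of real-rooted polynomials -/

theorem tsum_mul_zero_pow (c : ℕ → ℝ) : ∑' j, c j * (0 : ℝ) ^ j = c 0 := by
  rw [tsum_eq_single 0 fun j hj => by rw [zero_pow hj, mul_zero]]; simp

/-- A power series positive at the origin and negative at `p` has a least positive zero. -/
theorem exists_isLeast_zero_tsum {c B : ℕ → ℝ} (hc : ∀ j, |c j| ≤ B j)
    (hB : ∀ R : ℝ, Summable fun j => B j * R ^ j) (hc0 : 0 < c 0) {p : ℝ} (hp : 0 < p)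
    (hfp : ∑' j, c j * p ^ j < 0) :
    ∃ x₀ < p, IsLeast {x : ℝ | 0 < x ∧ ∑' j, c j * x ^ j = 0} x₀ := by
  have hcont := continuousOn_tsum_mul_pow hc hB p
  have hcomp : IsCompact (Set.Icc 0 p ∩ (fun x => ∑' j, c j * x ^ j) ⁻¹' {0}) :=
    isCompact_Icc.of_isClosed_subset
      (hcont.preimage_isClosed_of_isClosed isClosed_Icc isClosed_singleton) Set.inter_subset_left
  obtain ⟨z, hz, hz0⟩ : (0 : ℝ) ∈ (fun x => ∑' j, c j * x ^ j) '' Set.Icc 0 p := by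
    refine intermediate_value_Icc' hp.le hcont ⟨hfp.le, ?_⟩
    show 0 ≤ ∑' j, c j * (0 : ℝ) ^ j
    rw [tsum_mul_zero_pow]; exact hc0.le
  obtain ⟨x₀, ⟨hx₀, hx₀0⟩, hmin⟩ := hcomp.exists_isLeast ⟨z, hz, hz0⟩
  have hx₀0' : ∑' j, c j * x₀ ^ j = 0 := hx₀0
  have hpos : 0 < x₀ := by
    rcases hx₀.1.lt_or_eq with h | h
    · exact h
    · rw [← h, tsum_mul_zero_pow] at hx₀0'; exact absurd hx₀0' hc0.ne'
  have hlt : x₀ < p := by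
    rcases hx₀.2.lt_or_eq with h | h
    · exact h
    · rw [h] at hx₀0'; exact absurd hx₀0' hfp.ne
  refine ⟨x₀, hlt, ⟨hpos, hx₀0'⟩, fun y hy => ?_⟩
  by_contra! hlt'
  exact absurd (hmin ⟨⟨hy.1.le, (hlt'.trans hlt).le⟩, hy.2⟩) (not_le.2 hlt')

section Limit

variable {Y : ℕ → Multiset ℝ} {c B : ℕ → ℝ} {x₀ p₁ p₂ : ℝ}

/-- A sign change of the limit traps a reciprocal root of the approximants. -/
theorem eventually_exists_mem_of_sign_change
    (hlim : ∀ j, Tendsto (fun n => (prodOneSub (Y n)).coeff j) atTop (𝓝 (c j)))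
    (hdom : ∀ᶠ n in atTop, ∀ j, |(prodOneSub (Y n)).coeff j| ≤ B j)
    (hB : ∀ R : ℝ, Summable fun j => B j * R ^ j) (hp₁ : 0 < p₁) (hp : p₁ < p₂)
    (hf₁ : ∑' j, c j * p₁ ^ j < 0) (hf₂ : 0 < ∑' j, c j * p₂ ^ j) :
    ∀ᶠ n in atTop, ∃ y ∈ Y n, p₂⁻¹ ≤ y ∧ y ≤ p₁⁻¹ := by
  have hp₂ : 0 < p₂ := hp₁.trans hp
  filter_upwards [eventually_abs_eval_sub_tsum_lt hlim hdom hB hp₂.le (neg_pos.2 hf₁),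
    eventually_abs_eval_sub_tsum_lt hlim hdom hB hp₂.le hf₂] with n h₁ h₂
  have h₁' := (abs_lt.1 (h₁ p₁ hp₁.le hp.le)).2
  have h₂' := (abs_lt.1 (h₂ p₂ hp₂.le le_rfl)).1
  obtain ⟨r, hr, hr0⟩ : (0 : ℝ) ∈ (fun x => (prodOneSub (Y n)).eval x) '' Set.Icc p₁ p₂ :=
    intermediate_value_Icc hp.le (prodOneSub (Y n)).continuous.continuousOn
      ⟨by show eval p₁ _ ≤ 0; linarith, by show 0 ≤ eval p₂ _; linarith⟩
  have hr0' : (prodOneSub (Y n)).eval r = 0 := hr0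
  rw [eval_prodOneSub, Multiset.prod_eq_zero_iff] at hr0'
  obtain ⟨y, hy, hy0⟩ := Multiset.mem_map.1 hr0'
  have hrpos : 0 < r := hp₁.trans_le hr.1
  have hyr : y = r⁻¹ := eq_inv_of_mul_eq_one_left (by linarith)
  exact ⟨y, hy, hyr ▸ inv_anti₀ hrpos hr.2, hyr ▸ inv_anti₀ hp₁ hr.1⟩

/-- Near a zero `x₀` of the limit the approximants are small, so some reciprocal root is almost
`x₀⁻¹` or larger. -/
theorem eventually_exists_mem_gt (hY : ∀ n, ∀ y ∈ Y n, 0 < y)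
    (hlim : ∀ j, Tendsto (fun n => (prodOneSub (Y n)).coeff j) atTop (𝓝 (c j)))
    (hdom : ∀ᶠ n in atTop, ∀ j, |(prodOneSub (Y n)).coeff j| ≤ B j)
    (hB : ∀ R : ℝ, Summable fun j => B j * R ^ j) (hx₀ : 0 < x₀)
    (hf : ∑' j, c j * x₀ ^ j = 0) {d : ℝ} (hd : d < x₀⁻¹) :
    ∀ᶠ n in atTop, ∃ y ∈ Y n, d < y := by
  have hε : 0 < 1 - d * x₀ := by
    have := mul_lt_mul_of_pos_right hd hx₀
    rw [inv_mul_cancel₀ hx₀.ne'] at this; linarith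
  set ε := 1 - d * x₀
  set E := Real.exp (-(x₀ * (-c 1 + 1) / ε))
  have hs : ∀ᶠ n in atTop, powerSum (Y n) 1 < -c 1 + 1 := by
    have : Tendsto (fun n => powerSum (Y n) 1) atTop (𝓝 (-c 1)) := by
      simpa only [powerSum_one] using (hlim 1).neg
    exact this.eventually (gt_mem_nhds (by linarith))
  filter_upwards [hs, eventually_abs_eval_sub_tsum_lt hlim hdom hB hx₀.le (Real.exp_pos _ : 0 < E)]
    with n hn hE
  by_contra! hcon
  have h1 := exp_le_eval_prodOneSub (hY n) hx₀ hε fun y hy => by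
    have := mul_le_mul_of_nonneg_right (hcon y hy) hx₀.le
    simp only [ε]; linarith
  have h2 := (abs_lt.1 (hE x₀ hx₀.le le_rfl)).2
  rw [hf, sub_zero] at h2
  have h3 : E ≤ Real.exp (-(x₀ * powerSum (Y n) 1 / ε)) := by
    apply Real.exp_le_exp.2
    gcongr
  linarith

/-- The limit is bounded away from zero before its least zero `x₀`, so no reciprocal root exceeds
`x₀⁻¹` by much. -/
theorem eventually_forall_mem_le (hY : ∀ n, ∀ y ∈ Y n, 0 < y)
    (hlim : ∀ j, Tendsto (fun n => (prodOneSub (Y n)).coeff j) atTop (𝓝 (c j)))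
    (hdom : ∀ᶠ n in atTop, ∀ j, |(prodOneSub (Y n)).coeff j| ≤ B j)
    (hB : ∀ R : ℝ, Summable fun j => B j * R ^ j) (hc0 : 0 < c 0)
    (hx₀ : IsLeast {x : ℝ | 0 < x ∧ ∑' j, c j * x ^ j = 0} x₀) {d : ℝ} (hd : x₀⁻¹ < d) :
    ∀ᶠ n in atTop, ∀ y ∈ Y n, y ≤ d := by
  have hx₀pos : 0 < x₀ := hx₀.1.1
  have hdpos : 0 < d := (inv_pos.2 hx₀pos).trans hd
  have hc : ∀ j, |c j| ≤ B j := fun j =>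
    le_of_tendsto (hlim j).abs (hdom.mono fun n hn => hn j)
  have hcont := continuousOn_tsum_mul_pow hc hB d⁻¹
  obtain ⟨m, hm, hmin⟩ := isCompact_Icc.exists_isMinOn
    (Set.nonempty_Icc.2 (inv_pos.2 hdpos).le) hcont
  have hd' : d⁻¹ < x₀ := inv_lt_of_inv_lt₀ hx₀pos hd
  have hpos : 0 < ∑' j, c j * m ^ j := by
    by_contra! hle
    obtain ⟨z, hz, hz0⟩ : (0 : ℝ) ∈ (fun x => ∑' j, c j * x ^ j) '' Set.Icc 0 m := by
      refine intermediate_value_Icc' hm.1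
        (hcont.mono (Set.Icc_subset_Icc_right hm.2)) ⟨hle, ?_⟩
      show 0 ≤ ∑' j, c j * (0 : ℝ) ^ j
      rw [tsum_mul_zero_pow]; exact hc0.le
    have hz0' : ∑' j, c j * z ^ j = 0 := hz0
    have hzpos : 0 < z := by
      rcases hz.1.lt_or_eq with h | h
      · exact h
      · rw [← h, tsum_mul_zero_pow] at hz0'; exact absurd hz0' hc0.ne'
    have := hx₀.2 ⟨hzpos, hz0'⟩
    linarith [hz.2, hm.2]
  filter_upwards [eventually_abs_eval_sub_tsum_lt hlim hdom hB (inv_pos.2 hdpos).le hpos]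
    with n hn y hy
  by_contra! hlt
  have hypos := hY n y hy
  have hle : y⁻¹ ≤ d⁻¹ := inv_anti₀ hdpos hlt.le
  have h1 := (abs_lt.1 (hn y⁻¹ (inv_pos.2 hypos).le hle)).1
  have h2 : (prodOneSub (Y n)).eval y⁻¹ = 0 := by
    rw [eval_prodOneSub]
    exact Multiset.prod_eq_zero
      (Multiset.mem_map.2 ⟨y, hy, by rw [mul_inv_cancel₀ hypos.ne', sub_self]⟩)
  have h3 : ∑' j, c j * m ^ j ≤ ∑' j, c j * (y⁻¹) ^ j :=
    isMinOn_iff.1 hmin _ ⟨(inv_pos.2 hypos).le, hle⟩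
  linarith

/-- Strict lower Euler-Rayleigh bound: the second zero trapped in `[p₁, p₂]` keeps a fixed
distance between the limit of the power sums and `x₀⁻¹ ^ k`. -/
theorem inv_pow_lt_of_tendsto_powerSum (hY : ∀ n, ∀ y ∈ Y n, 0 < y)
    (hlim : ∀ j, Tendsto (fun n => (prodOneSub (Y n)).coeff j) atTop (𝓝 (c j)))
    (hdom : ∀ᶠ n in atTop, ∀ j, |(prodOneSub (Y n)).coeff j| ≤ B j)
    (hB : ∀ R : ℝ, Summable fun j => B j * R ^ j) (hx₀ : 0 < x₀)
    (hf : ∑' j, c j * x₀ ^ j = 0) (hp₁ : x₀ < p₁) (hp : p₁ < p₂)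
    (hf₁ : ∑' j, c j * p₁ ^ j < 0) (hf₂ : 0 < ∑' j, c j * p₂ ^ j) {k : ℕ} {s : ℝ}
    (hs : Tendsto (fun n => powerSum (Y n) k) atTop (𝓝 s)) : (x₀⁻¹) ^ k < s := by
  have hp₁0 : 0 < p₁ := hx₀.trans hp₁
  have hp₂0 : 0 < p₂ := hp₁0.trans hp
  have hlt : p₁⁻¹ < x₀⁻¹ := inv_strictAnti₀ hx₀ hp₁
  have key : ∀ d, p₁⁻¹ < d → d < x₀⁻¹ → d ^ k + (p₂⁻¹) ^ k ≤ s := by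
    intro d hd₁ hd₂
    refine ge_of_tendsto hs ?_
    filter_upwards [eventually_exists_mem_of_sign_change hlim hdom hB hp₁0 hp hf₁ hf₂,
      eventually_exists_mem_gt hY hlim hdom hB hx₀ hf hd₂] with n ⟨v, hv, hv₁, hv₂⟩ ⟨u, hu, hu₁⟩
    have h := add_pow_le_powerSum (hY n) hu hv (by linarith : v < u).ne' k
    have h1 : d ^ k ≤ u ^ k := pow_le_pow_left₀ ((inv_pos.2 hp₁0).trans hd₁).le hu₁.le k
    have h2 : (p₂⁻¹) ^ k ≤ v ^ k := pow_le_pow_left₀ (inv_pos.2 hp₂0).le hv₁ k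
    linarith
  have hle : (x₀⁻¹) ^ k + (p₂⁻¹) ^ k ≤ s := by
    have ht : Tendsto (fun d : ℝ => d ^ k + (p₂⁻¹) ^ k) (𝓝[<] x₀⁻¹)
        (𝓝 ((x₀⁻¹) ^ k + (p₂⁻¹) ^ k)) :=
      (Continuous.tendsto (by fun_prop) _).mono_left nhdsWithin_le_nhds
    refine le_of_tendsto ht ?_
    filter_upwards [Ioo_mem_nhdsLT hlt] with d hd using key d hd.1 hd.2
  have : 0 < (p₂⁻¹) ^ k := pow_pos (inv_pos.2 hp₂0) k
  linarith

/-- Strict upper Euler-Rayleigh bound, again by means of the second zero. -/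
theorem lt_inv_mul_of_tendsto_powerSum (hY : ∀ n, ∀ y ∈ Y n, 0 < y)
    (hlim : ∀ j, Tendsto (fun n => (prodOneSub (Y n)).coeff j) atTop (𝓝 (c j)))
    (hdom : ∀ᶠ n in atTop, ∀ j, |(prodOneSub (Y n)).coeff j| ≤ B j)
    (hB : ∀ R : ℝ, Summable fun j => B j * R ^ j) (hc0 : 0 < c 0)
    (hx₀ : IsLeast {x : ℝ | 0 < x ∧ ∑' j, c j * x ^ j = 0} x₀) (hp₁ : x₀ < p₁) (hp : p₁ < p₂)
    (hf₁ : ∑' j, c j * p₁ ^ j < 0) (hf₂ : 0 < ∑' j, c j * p₂ ^ j) {k : ℕ} {s t : ℝ}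
    (hs : Tendsto (fun n => powerSum (Y n) k) atTop (𝓝 s))
    (ht : Tendsto (fun n => powerSum (Y n) (k + 1)) atTop (𝓝 t)) : t < x₀⁻¹ * s := by
  have hx₀pos : 0 < x₀ := hx₀.1.1
  have hp₁0 : 0 < p₁ := hx₀pos.trans hp₁
  have hp₂0 : 0 < p₂ := hp₁0.trans hp
  have hlt : p₁⁻¹ < x₀⁻¹ := inv_strictAnti₀ hx₀pos hp₁
  have key : ∀ d, x₀⁻¹ < d → (p₂⁻¹) ^ k * (d - p₁⁻¹) ≤ d * s - t := by
    intro d hd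
    refine ge_of_tendsto ((hs.const_mul d).sub ht) ?_
    filter_upwards [eventually_exists_mem_of_sign_change hlim hdom hB hp₁0 hp hf₁ hf₂,
      eventually_forall_mem_le hY hlim hdom hB hc0 hx₀ hd] with n ⟨v, hv, hv₁, hv₂⟩ hle
    refine le_trans ?_ (pow_mul_sub_le_powerSum (hY n) hle hv k)
    have h2 : (p₂⁻¹) ^ k ≤ v ^ k := pow_le_pow_left₀ (inv_pos.2 hp₂0).le hv₁ k
    exact mul_le_mul h2 (by linarith) (by linarith) (pow_nonneg (hY n v hv).le k)
  have hle : (p₂⁻¹) ^ k * (x₀⁻¹ - p₁⁻¹) ≤ x₀⁻¹ * s - t := by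
    have h1 : Tendsto (fun d : ℝ => (p₂⁻¹) ^ k * (d - p₁⁻¹)) (𝓝[>] x₀⁻¹)
        (𝓝 ((p₂⁻¹) ^ k * (x₀⁻¹ - p₁⁻¹))) :=
      (Continuous.tendsto (by fun_prop) _).mono_left nhdsWithin_le_nhds
    have h2 : Tendsto (fun d : ℝ => d * s - t) (𝓝[>] x₀⁻¹) (𝓝 (x₀⁻¹ * s - t)) :=
      (Continuous.tendsto (by fun_prop) _).mono_left nhdsWithin_le_nhds
    refine le_of_tendsto_of_tendsto h1 h2 ?_
    filter_upwards [self_mem_nhdsWithin] with d hd using key d hd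
  have : 0 < (p₂⁻¹) ^ k * (x₀⁻¹ - p₁⁻¹) := by
    have := inv_pos.2 hp₂0
    exact mul_pos (pow_pos this k) (by linarith)
  linarith

end Limit

/-! ### Pólya's theorem for sine polynomials with increasing weights -/

/-- The polynomials `S_k` with `sin (k θ) = sin θ * S_k (2 - 2 cos θ)`: the Chebyshev polynomials
of the second kind, recentred so that small arguments correspond to small angles. -/
noncomputable def sinQuot : ℕ → ℝ[X]
  | 0 => 0
  | 1 => 1
  | k + 2 => (2 - X) * sinQuot (k + 1) - sinQuot k

theorem coeff_sinQuot (k j : ℕ) :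
    (sinQuot k).coeff j = (-1) ^ j * ((k + j).choose (2 * j + 1) : ℝ) := by
  induction k using Nat.twoStepInduction generalizing j with
  | zero => simp [sinQuot, Nat.choose_eq_zero_of_lt (show j < 2 * j + 1 by omega)]
  | one =>
    rcases j with _ | j
    · simp [sinQuot]
    · simp [sinQuot, coeff_one,
        Nat.choose_eq_zero_of_lt (show 1 + (j + 1) < 2 * (j + 1) + 1 by omega)]
  | more k ih₁ ih₂ =>
    have h2 : (2 : ℝ[X]) = C 2 := (map_ofNat C 2).symm
    rcases j with _ | j
    · rw [sinQuot, sub_mul, coeff_sub, coeff_sub, h2, coeff_C_mul, ih₁, ih₂]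
      simp only [Nat.mul_zero, Nat.zero_add, Nat.choose_one_right, add_zero, mul_coeff_zero,
        coeff_X_zero]
      push_cast
      ring
    · rw [sinQuot, sub_mul, coeff_sub, coeff_sub, h2, coeff_C_mul, coeff_X_mul, ih₁, ih₂, ih₂]
      have e1 : k + 2 + (j + 1) = k + j + 1 + 2 := by ring
      have e2 : k + 1 + (j + 1) = k + j + 1 + 1 := by ring
      have e3 : 2 * (j + 1) + 1 = 2 * j + 1 + 1 + 1 := by ring
      have e4 : k + (j + 1) = k + j + 1 := by ring
      have e5 : k + 1 + j = k + j + 1 := by ring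
      rw [e1, e2, e3, e4, e5, Nat.choose_succ_succ' (k + j + 1 + 1) (2 * j + 1 + 1),
        Nat.choose_succ_succ' (k + j + 1) (2 * j + 1 + 1),
        Nat.choose_succ_succ' (k + j + 1) (2 * j + 1)]
      push_cast
      ring

theorem sub_inv_mul_aeval_sinQuot {q : ℂ} (hq : q ≠ 0) (k : ℕ) :
    (q - q⁻¹) * aeval (2 - q - q⁻¹) (sinQuot k) = q ^ k - (q⁻¹) ^ k := by
  induction k using Nat.twoStepInduction with
  | zero => simp [sinQuot]
  | one => simp [sinQuot]
  | more k ih₁ ih₂ =>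
    have h2 : aeval (2 - q - q⁻¹) (2 : ℝ[X]) = 2 := map_ofNat _ 2
    rw [sinQuot, map_sub, map_mul, map_sub, aeval_X, h2, mul_sub, mul_left_comm, ih₁, ih₂,
      inv_pow, inv_pow, inv_pow]
    field_simp
    ring

/-- `s ^ 2 + s⁻¹ ^ 2` lies on an ellipse with foci `±2` whose size depends on `‖s‖` only. -/
theorem norm_sub_two_add_norm_add_two {s : ℂ} (hs : s ≠ 0) :
    ‖s ^ 2 + s⁻¹ ^ 2 - 2‖ + ‖s ^ 2 + s⁻¹ ^ 2 + 2‖ = 2 * (‖s‖ ^ 2 + (‖s‖ ^ 2)⁻¹) := by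
  have h1 : s ^ 2 + s⁻¹ ^ 2 - 2 = (s - s⁻¹) ^ 2 := by field_simp; ring
  have h2 : s ^ 2 + s⁻¹ ^ 2 + 2 = (s + s⁻¹) ^ 2 := by field_simp; ring
  rw [h1, h2, norm_pow, norm_pow]
  have := parallelogram_law_with_norm ℝ s s⁻¹
  rw [norm_inv] at this
  rw [← inv_pow]
  linarith

/-- The gauge of the confocal ellipses with foci `±2` is convex, so a positive combination of
points inside the ellipse through `Z n` cannot reproduce the point `Z (n + 1)` of a larger one. -/
theorem sum_mul_sub_ne_zero {w : ℕ → ℝ} (hw0 : 0 ≤ w 0) {n : ℕ}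
    (hw : ∀ k < n, w k ≤ w (k + 1)) (hn : 0 < w n) {Z : ℕ → ℂ}
    (hZ : ∀ k, ‖Z k - 2‖ + ‖Z k + 2‖ < ‖Z (k + 1) - 2‖ + ‖Z (k + 1) + 2‖) :
    ∑ k ∈ Finset.range (n + 1), (w k : ℂ) * (Z (k + 1) - Z k) ≠ 0 := by
  have key : ∀ m ≤ n, 0 ≤ w m ∧
      ‖w m * (Z (m + 1) - 2) - ∑ k ∈ Finset.range (m + 1), (w k : ℂ) * (Z (k + 1) - Z k)‖
      + ‖w m * (Z (m + 1) + 2) - ∑ k ∈ Finset.range (m + 1), (w k : ℂ) * (Z (k + 1) - Z k)‖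
      ≤ w m * (‖Z m - 2‖ + ‖Z m + 2‖) := by
    intro m
    induction m with
    | zero =>
      intro _
      refine ⟨hw0, le_of_eq ?_⟩
      rw [Finset.sum_range_one]
      have e1 : (w 0 : ℂ) * (Z (0 + 1) - 2) - w 0 * (Z (0 + 1) - Z 0) = w 0 * (Z 0 - 2) := by ring
      have e2 : (w 0 : ℂ) * (Z (0 + 1) + 2) - w 0 * (Z (0 + 1) - Z 0) = w 0 * (Z 0 + 2) := by ring
      rw [e1, e2, norm_mul, norm_mul, Complex.norm_real, Real.norm_of_nonneg hw0]; ring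
    | succ m ih =>
      intro hm
      obtain ⟨h0, ih⟩ := ih (by omega)
      have hwm := hw m (by omega)
      refine ⟨h0.trans hwm, ?_⟩
      rw [Finset.sum_range_succ]
      set T := ∑ k ∈ Finset.range (m + 1), (w k : ℂ) * (Z (k + 1) - Z k)
      have e1 : (w (m + 1) : ℂ) * (Z (m + 1 + 1) - 2)
          - (T + w (m + 1) * (Z (m + 1 + 1) - Z (m + 1)))
          = (w m * (Z (m + 1) - 2) - T) + ((w (m + 1) - w m : ℝ) : ℂ) * (Z (m + 1) - 2) := by
        push_cast; ring
      have e2 : (w (m + 1) : ℂ) * (Z (m + 1 + 1) + 2)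
          - (T + w (m + 1) * (Z (m + 1 + 1) - Z (m + 1)))
          = (w m * (Z (m + 1) + 2) - T) + ((w (m + 1) - w m : ℝ) : ℂ) * (Z (m + 1) + 2) := by
        push_cast; ring
      rw [e1, e2]
      have n1 := norm_add_le (w m * (Z (m + 1) - 2) - T)
        (((w (m + 1) - w m : ℝ) : ℂ) * (Z (m + 1) - 2))
      have n2 := norm_add_le (w m * (Z (m + 1) + 2) - T)
        (((w (m + 1) - w m : ℝ) : ℂ) * (Z (m + 1) + 2))
      rw [norm_mul _ (Z (m + 1) - 2), Complex.norm_real, Real.norm_of_nonneg (by linarith)] at n1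
      rw [norm_mul _ (Z (m + 1) + 2), Complex.norm_real, Real.norm_of_nonneg (by linarith)] at n2
      have := mul_le_mul_of_nonneg_left (hZ m).le h0
      linarith
  intro h
  have := (key n le_rfl).2
  rw [h, sub_zero, sub_zero, norm_mul, norm_mul, Complex.norm_real, Real.norm_of_nonneg hn.le,
    ← mul_add] at this
  exact absurd this (not_le.2 (mul_lt_mul_of_pos_left (hZ n) hn))

theorem sum_mul_pow_sub_ne_zero {w : ℕ → ℝ} (hw0 : 0 ≤ w 0) {n : ℕ}
    (hw : ∀ k < n, w k ≤ w (k + 1)) (hn : 0 < w n) {q : ℂ} (hq : 1 < ‖q‖) :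
    ∑ k ∈ Finset.range (n + 1), (w k : ℂ) * (q ^ (k + 1) - (q⁻¹) ^ (k + 1)) ≠ 0 := by
  obtain ⟨u, rfl⟩ := IsAlgClosed.exists_pow_nat_eq q (show 0 < 4 by norm_num)
  have hu : 1 < ‖u‖ := by
    rw [norm_pow] at hq
    exact (one_lt_pow_iff_of_nonneg (norm_nonneg u) (by norm_num)).1 hq
  have hu0 : u ≠ 0 := fun h => by rw [h, norm_zero] at hu; linarith
  -- With `q = u ^ 4`, multiplication by `q ^ (1/2) - q ^ (-1/2)` makes every term a difference of
  -- consecutive `Z k = q ^ (k + 1/2) + q ^ (-k - 1/2)`.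
  set Z : ℕ → ℂ := fun k => (u ^ (2 * k + 1)) ^ 2 + (u ^ (2 * k + 1))⁻¹ ^ 2 with hZdef
  have hZ : ∀ k, ‖Z k - 2‖ + ‖Z k + 2‖ < ‖Z (k + 1) - 2‖ + ‖Z (k + 1) + 2‖ := by
    intro k
    rw [hZdef, norm_sub_two_add_norm_add_two (pow_ne_zero _ hu0),
      norm_sub_two_add_norm_add_two (pow_ne_zero _ hu0), norm_pow, norm_pow]
    set r := (‖u‖ ^ (2 * k + 1)) ^ 2
    have hr : 1 ≤ r := one_le_pow₀ (one_le_pow₀ hu.le)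
    have e : (‖u‖ ^ (2 * (k + 1) + 1)) ^ 2 = r * ‖u‖ ^ 4 := by simp only [r]; ring
    rw [e]
    rw [norm_pow] at hq
    set ρ := ‖u‖ ^ 4
    have hρ : 0 < ρ := by linarith
    have hr0 : 0 < r := by linarith
    have h1 : r * ρ + (r * ρ)⁻¹ - (r + r⁻¹) = (ρ - 1) * (r * (r * ρ) - 1) / (r * ρ) := by
      field_simp; ring
    have h2 : 1 < r * (r * ρ) := by nlinarith [mul_pos hr0 hρ]
    have h3 : 0 < (ρ - 1) * (r * (r * ρ) - 1) / (r * ρ) :=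
      div_pos (mul_pos (by linarith) (by linarith)) (mul_pos hr0 hρ)
    linarith
  intro h
  refine sum_mul_sub_ne_zero hw0 hw hn hZ ?_
  have e : ∀ k, Z (k + 1) - Z k = ((u ^ 4) ^ (k + 1) - ((u ^ 4)⁻¹) ^ (k + 1)) * (u ^ 2 - (u ^ 2)⁻¹) := by
    intro k
    simp only [hZdef, inv_pow]
    field_simp
    ring
  simp only [e, ← mul_assoc]
  rw [← Finset.sum_mul, h, zero_mul]

/-- Pólya's theorem for sine polynomials: if the weights are nonnegative and increasing, the zeros
of `∑ w_k sin ((k + 1) θ) / sin θ` in the variable `2 - 2 cos θ` are all real and positive. -/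
theorem im_eq_zero_and_re_pos_of_aeval_sum_sinQuot {w : ℕ → ℝ} (hw0 : 0 ≤ w 0) {n : ℕ}
    (hw : ∀ k < n, w k ≤ w (k + 1)) (hn : 0 < w n) {y : ℂ}
    (hy : aeval y (∑ k ∈ Finset.range (n + 1), C (w k) * sinQuot (k + 1)) = 0) :
    y.im = 0 ∧ 0 < y.re := by
  have hy' : ∑ k ∈ Finset.range (n + 1), (w k : ℂ) * aeval y (sinQuot (k + 1)) = 0 := by
    simpa using hy
  have hwk : ∀ k ≤ n, 0 ≤ w k := by
    intro k
    induction k with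
    | zero => exact fun _ => hw0
    | succ k ih => exact fun hk => (ih (by omega)).trans (hw k (by omega))
  obtain ⟨s, hs⟩ := IsAlgClosed.exists_pow_nat_eq ((2 - y) ^ 2 - 4) (show 0 < 2 by norm_num)
  set q := (2 - y + s) / 2 with hqdef
  have hquad : q * (2 - y - q) = 1 := by
    have : q * (2 - y - q) = ((2 - y) ^ 2 - s ^ 2) / 4 := by rw [hqdef]; ring
    rw [this, hs]; ring
  have hq0 : q ≠ 0 := fun h => by rw [h, zero_mul] at hquad; exact zero_ne_one hquad
  have hqy : y = 2 - q - q⁻¹ := by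
    rw [inv_eq_of_mul_eq_one_right hquad]; ring
  have hnot : ∀ p : ℂ, p ≠ 0 → y = 2 - p - p⁻¹ → ¬ 1 < ‖p‖ := by
    intro p hp0 hpy hp
    refine sum_mul_pow_sub_ne_zero hw0 hw hn hp ?_
    simp only [← sub_inv_mul_aeval_sinQuot hp0]
    rw [← hpy]
    simp only [mul_left_comm _ (p - p⁻¹)]
    rw [← Finset.mul_sum, hy', mul_zero]
  have h1 : ‖q‖ ≤ 1 := not_lt.1 (hnot q hq0 hqy)
  have h2 : ‖q⁻¹‖ ≤ 1 := not_lt.1 (hnot q⁻¹ (inv_ne_zero hq0) (by rw [inv_inv, hqy]; ring))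
  have h3 : ‖q‖ = 1 := by
    refine le_antisymm h1 ?_
    rw [norm_inv] at h2
    exact (inv_le_one₀ (norm_pos_iff.2 hq0)).1 h2
  have hconj : q⁻¹ = (starRingEnd ℂ) q := Complex.inv_eq_conj h3
  have him : y.im = 0 := by rw [hqy, hconj]; simp
  have hre : y.re = 2 - 2 * q.re := by rw [hqy, hconj]; simp; ring
  refine ⟨him, ?_⟩
  have hqre : q.re ≤ 1 := (Complex.re_le_norm q).trans h1
  rcases hqre.lt_or_eq with h | h
  · linarith
  · exfalso
    have hy0 : y = 0 := Complex.ext (by rw [hre, h]; simp) him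
    have hval : ∀ k, aeval (0 : ℂ) (sinQuot (k + 1)) = (((k : ℝ) + 1 : ℝ) : ℂ) := by
      intro k
      rw [← coeff_zero_eq_aeval_zero', coeff_sinQuot]; simp
    simp only [hy0, hval] at hy'
    have hy'' : ∑ k ∈ Finset.range (n + 1), w k * ((k : ℝ) + 1) = 0 := by
      exact_mod_cast hy'
    have hpos : 0 < ∑ k ∈ Finset.range (n + 1), w k * ((k : ℝ) + 1) := by
      refine Finset.sum_pos' (fun k hk => mul_nonneg (hwk k ?_) (by positivity))
        ⟨n, by simp, by positivity⟩
      have := Finset.mem_range.1 hk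
      omega
    linarith

/-- If all zeros of `p` are positive reals, so are those of `a p + 2 x p'` with `a > 0`: away from
the zeros of `p` one has `a + 2 ∑ z / (z - r) = 0`, and the terms `z / (z - r)` all have imaginary
parts of the same sign, and nonnegative real part for real `z ≤ 0`. -/
theorem im_eq_zero_and_re_pos_of_aeval_add_derivative {p : ℝ[X]}
    (hp : ∀ z : ℂ, aeval z p = 0 → z.im = 0 ∧ 0 < z.re) {a : ℝ} (ha : 0 < a) {z : ℂ}
    (hz : aeval z (C a * p + 2 * X * derivative p) = 0) : z.im = 0 ∧ 0 < z.re := by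
  by_cases hpz : aeval z p = 0
  · exact hp z hpz
  set P := p.map (algebraMap ℝ ℂ) with hP
  have hPz : P.eval z ≠ 0 := by rwa [hP, eval_map_algebraMap]
  have hroots : ∀ r ∈ P.roots, r.im = 0 ∧ 0 < r.re := by
    intro r hr
    refine hp r ?_
    rw [← eval_map_algebraMap]
    exact (mem_roots'.1 hr).2
  have hder := (IsAlgClosed.splits P).eval_derivative_eq_eval_mul_sum hPz
  have hsum : (a : ℂ) + 2 * (P.roots.map fun r => z * (1 / (z - r))).sum = 0 := by
    have h2 : aeval z (2 : ℝ[X]) = 2 := map_ofNat _ 2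
    have : (a : ℂ) * P.eval z + 2 * z * P.derivative.eval z = 0 := by
      rw [hP, derivative_map, eval_map_algebraMap, eval_map_algebraMap]
      simpa [h2] using hz
    rw [hder] at this
    rw [Multiset.sum_map_mul_left]
    have h3 : P.eval z * ((a : ℂ) + 2 * (z * (P.roots.map fun r => 1 / (z - r)).sum)) = 0 := by
      rw [← this]; ring
    exact (mul_eq_zero.1 h3).resolve_left hPz
  have hterm : ∀ r ∈ P.roots,
      (z * (1 / (z - r))).re = (Complex.normSq z - r.re * z.re) / Complex.normSq (z - r) ∧
      (z * (1 / (z - r))).im = -z.im * (r.re / Complex.normSq (z - r)) := by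
    intro r hr
    have hr0 := (hroots r hr).1
    rw [one_div, Complex.inv_def, ← mul_assoc, Complex.re_mul_ofReal, Complex.im_mul_ofReal]
    constructor
    · simp [Complex.normSq_apply, hr0]; ring
    · simp [hr0]; ring
  have hpos : ∀ r ∈ P.roots, 0 < Complex.normSq (z - r) := by
    intro r hr
    refine Complex.normSq_pos.2 fun h => hPz ?_
    rw [sub_eq_zero.1 h]
    exact (mem_roots'.1 hr).2
  have hre : a + 2 * (P.roots.map fun r =>
      (Complex.normSq z - r.re * z.re) / Complex.normSq (z - r)).sum = 0 := by
    have h1 := congrArg Complex.re hsum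
    have h2 : (P.roots.map fun r => z * (1 / (z - r))).sum.re
        = (P.roots.map fun r => (z * (1 / (z - r))).re).sum := by
      have := map_multiset_sum Complex.reAddGroupHom (P.roots.map fun r => z * (1 / (z - r)))
      rwa [Multiset.map_map] at this
    rw [← Multiset.map_congr rfl fun r hr => (hterm r hr).1, ← h2]
    simpa using h1
  have him : -z.im * (P.roots.map fun r => r.re / Complex.normSq (z - r)).sum = 0 := by
    have h1 := congrArg Complex.im hsum
    have h2 : (P.roots.map fun r => z * (1 / (z - r))).sum.im
        = (P.roots.map fun r => (z * (1 / (z - r))).im).sum := by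
      have := map_multiset_sum Complex.imAddGroupHom (P.roots.map fun r => z * (1 / (z - r)))
      rwa [Multiset.map_map] at this
    rw [← Multiset.sum_map_mul_left, ← Multiset.map_congr rfl fun r hr => (hterm r hr).2, ← h2]
    simpa using h1
  have him0 : z.im = 0 := by
    by_contra hne
    have h0 := (mul_eq_zero.1 him).resolve_left (neg_ne_zero.2 hne)
    -- A vanishing sum of positive terms is empty, and then the real part reads `a = 0`.
    have hempty : P.roots = 0 := by
      by_contra hP0
      obtain ⟨r, hr⟩ := Multiset.exists_mem_of_ne_zero hP0
      obtain ⟨W, hW⟩ := Multiset.exists_cons_of_mem hr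
      have h1 : 0 < r.re / Complex.normSq (z - r) := div_pos (hroots r hr).2 (hpos r hr)
      have h2 : 0 ≤ (W.map fun r => r.re / Complex.normSq (z - r)).sum := by
        refine Multiset.sum_nonneg fun x hx => ?_
        obtain ⟨t, ht, rfl⟩ := Multiset.mem_map.1 hx
        exact div_nonneg (hroots t (by rw [hW]; simp [ht])).2.le (Complex.normSq_nonneg _)
      rw [hW, Multiset.map_cons, Multiset.sum_cons] at h0
      linarith
    rw [hempty] at hre
    simp at hre
    exact ha.ne' hre
  refine ⟨him0, ?_⟩
  by_contra! hle
  have : 0 ≤ (P.roots.map fun r =>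
      (Complex.normSq z - r.re * z.re) / Complex.normSq (z - r)).sum := by
    refine Multiset.sum_nonneg fun x hx => ?_
    obtain ⟨t, ht, rfl⟩ := Multiset.mem_map.1 hx
    refine div_nonneg ?_ (Complex.normSq_nonneg _)
    have := mul_nonneg (hroots t ht).2.le (neg_nonneg.2 hle)
    have := Complex.normSq_nonneg z
    linarith
  linarith

theorem exists_eq_C_mul_prodOneSub {p : ℝ[X]}
    (hp : ∀ z : ℂ, aeval z p = 0 → z.im = 0 ∧ 0 < z.re) :
    ∃ Y : Multiset ℝ, (∀ y ∈ Y, 0 < y) ∧ p = C (p.coeff 0) * prodOneSub Y := by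
  have hsplit : p.Splits := by
    refine Splits.of_splits_map (algebraMap ℝ ℂ) (IsAlgClosed.splits _) fun z hz => ?_
    have := hp z (by rw [← eval_map_algebraMap]; exact (mem_roots'.1 hz).2)
    exact ⟨z.re, Complex.ext (by simp) (by simp [this.1])⟩
  have hpos : ∀ r ∈ p.roots, 0 < r := by
    intro r hr
    have h := (hp r ?_).2
    · simpa using h
    · rw [← Complex.coe_algebraMap, aeval_algebraMap_apply, coe_aeval_eq_eval,
        (mem_roots'.1 hr).2.eq_zero, map_zero]
  refine ⟨p.roots.map fun r => r⁻¹, ?_, ?_⟩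
  · intro y hy
    obtain ⟨r, hr, rfl⟩ := Multiset.mem_map.1 hy
    exact inv_pos.2 (hpos r hr)
  · have key : ∀ R : Multiset ℝ, (∀ r ∈ R, 0 < r) → (R.map fun r => X - C r).prod
        = C ((R.map fun r => -r).prod) * prodOneSub (R.map fun r => r⁻¹) := by
      intro R
      induction R using Multiset.induction_on with
      | empty => simp [prodOneSub_zero]
      | cons r R ih =>
        intro h
        have hr : r ≠ 0 := (h r (by simp)).ne'
        have e : (X - C r : ℝ[X]) = C (-r) * (1 - C r⁻¹ * X) := by
          rw [mul_sub, ← mul_assoc, ← C_mul, neg_mul, mul_inv_cancel₀ hr]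
          simp; ring
        rw [Multiset.map_cons, Multiset.map_cons, Multiset.map_cons, Multiset.prod_cons,
          Multiset.prod_cons, prodOneSub_cons, ih fun t ht => h t (by simp [ht]), e, C_mul]
        ring
    have h1 := hsplit.eq_prod_roots
    rw [key _ hpos, ← mul_assoc, ← C_mul] at h1
    have h2 : p.coeff 0 = p.leadingCoeff * (p.roots.map fun r => -r).prod := by
      conv_lhs => rw [h1]
      rw [coeff_C_mul, coeff_zero_prodOneSub, mul_one]
    rw [h2]
    exact h1

/-! ### Polynomial approximation of finite sine transforms -/

theorem cast_descFactorial_add_two_step (m j : ℕ) :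
    ((m + (j + 1)).descFactorial (2 * (j + 1) + 1) : ℝ)
      = ((m : ℝ) ^ 2 - ((j : ℝ) + 1) ^ 2) * ((m + j).descFactorial (2 * j + 1) : ℝ) := by
  have h : (m + (j + 1)).descFactorial (2 * (j + 1) + 1)
      = (m + j + 1) * ((m + j - (2 * j + 1)) * (m + j).descFactorial (2 * j + 1)) := by
    rw [show m + (j + 1) = (m + j) + 1 by ring, show 2 * (j + 1) + 1 = (2 * j + 1 + 1) + 1 by ring,
      Nat.succ_descFactorial_succ, Nat.descFactorial_succ]
  rw [h]
  rcases le_or_gt (j + 1) m with hm | hm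
  · rw [show m + j - (2 * j + 1) = m - (j + 1) by omega]
    push_cast [hm]
    ring
  · rw [Nat.descFactorial_of_lt (show m + j < 2 * j + 1 by omega)]
    simp

theorem cast_descFactorial_le (m j : ℕ) :
    ((m + j).descFactorial (2 * j + 1) : ℝ) ≤ (m : ℝ) ^ (2 * j + 1) := by
  induction j with
  | zero => simp
  | succ j ih =>
    rw [cast_descFactorial_add_two_step, show 2 * (j + 1) + 1 = 2 + (2 * j + 1) by ring, pow_add]
    have h0 : (0 : ℝ) ≤ ((m + j).descFactorial (2 * j + 1) : ℝ) := by positivity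
    nlinarith [sq_nonneg ((j : ℝ) + 1), mul_le_mul_of_nonneg_left ih (sq_nonneg (m : ℝ)),
      mul_nonneg (sq_nonneg ((j : ℝ) + 1)) h0]

theorem cast_choose_eq (m j : ℕ) : ((m + j).choose (2 * j + 1) : ℝ)
    = ((m + j).descFactorial (2 * j + 1) : ℝ) / ((2 * j + 1).factorial : ℝ) := by
  rw [Nat.descFactorial_eq_factorial_mul_choose]
  push_cast
  rw [mul_div_cancel_left₀]
  exact_mod_cast (Nat.factorial_ne_zero _)

theorem tendsto_descFactorial_div (t : ℝ) (m : ℕ → ℕ)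
    (hm : Tendsto (fun n : ℕ => (m n : ℝ) / ((n : ℝ) + 1)) atTop (𝓝 t)) (j : ℕ) :
    Tendsto (fun n : ℕ => ((m n + j).descFactorial (2 * j + 1) : ℝ) / ((n : ℝ) + 1) ^ (2 * j + 1))
      atTop (𝓝 (t ^ (2 * j + 1))) := by
  induction j with
  | zero => simpa using hm
  | succ j ih =>
    have h1 : Tendsto (fun n : ℕ => ((j : ℝ) + 1) * (1 / ((n : ℝ) + 1))) atTop (𝓝 0) := by
      simpa using (tendsto_one_div_add_atTop_nhds_zero_nat (𝕜 := ℝ)).const_mul ((j : ℝ) + 1)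
    have h := ((hm.pow 2).sub (h1.pow 2)).mul ih
    rw [show (t ^ 2 - 0 ^ 2) * t ^ (2 * j + 1) = t ^ (2 * (j + 1) + 1) by ring] at h
    refine h.congr fun n => ?_
    rw [cast_descFactorial_add_two_step]
    have : (n : ℝ) + 1 ≠ 0 := by positivity
    field_simp
    ring

/-- The mass that `φ` gives to the `k`-th of `n + 1` equal subintervals of `[0, 1]`. -/
noncomputable def cellMass (φ : ℝ → ℝ) (n k : ℕ) : ℝ :=
  ∫ t in ((k : ℝ) / ((n : ℝ) + 1))..(((k + 1 : ℕ) : ℝ) / ((n : ℝ) + 1)), φ t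

/-- The discretization of `x ↦ ∫ φ(t) sin (t √x) / √x` obtained by concentrating the mass of each
cell at its right end: with `θ` defined by `x = (n + 1) ^ 2 (2 - 2 cos θ)`, so that
`√x ≈ (n + 1) θ`, it is `∑ cellMass φ n k * sin ((k + 1) θ) / ((n + 1) sin θ)`, a polynomial
in `x`. -/
noncomputable def sinApprox (φ : ℝ → ℝ) (n : ℕ) : ℝ[X] :=
  C ((n : ℝ) + 1)⁻¹ * (∑ k ∈ Finset.range (n + 1), C (cellMass φ n k) * sinQuot (k + 1)).comp
    (C (((n : ℝ) + 1) ^ 2)⁻¹ * X)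

theorem coeff_sinApprox (φ : ℝ → ℝ) (n j : ℕ) :
    (sinApprox φ n).coeff j = (-1) ^ j * ∑ k ∈ Finset.range (n + 1), cellMass φ n k *
      (((k + 1 + j).choose (2 * j + 1) : ℝ) / ((n : ℝ) + 1) ^ (2 * j + 1)) := by
  rw [sinApprox, coeff_C_mul, comp_C_mul_X_coeff, finsetSum_coeff, Finset.sum_mul, Finset.mul_sum,
    Finset.mul_sum]
  refine Finset.sum_congr rfl fun k _ => ?_
  rw [coeff_C_mul, coeff_sinQuot, inv_pow, ← pow_mul, pow_succ]
  have : (n : ℝ) + 1 ≠ 0 := by positivity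
  field_simp

section Weight

variable {φ : ℝ → ℝ} (hint : IntervalIntegrable φ volume 0 1)
  (hmono : MonotoneOn φ (Set.Ioo 0 1)) (hpos : ∀ t ∈ Set.Ioo (0 : ℝ) 1, 0 < φ t)

theorem div_mem_Icc {k n : ℕ} (hk : k ≤ n + 1) :
    (k : ℝ) / ((n : ℝ) + 1) ∈ Set.Icc (0 : ℝ) 1 := by
  refine ⟨by positivity, ?_⟩
  rw [div_le_one (by positivity)]
  exact_mod_cast hk

theorem div_lt_succ_div (k n : ℕ) :
    (k : ℝ) / ((n : ℝ) + 1) < ((k + 1 : ℕ) : ℝ) / ((n : ℝ) + 1) := by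
  have : (0 : ℝ) < (n : ℝ) + 1 := by positivity
  gcongr
  simp

include hint in
theorem intervalIntegrable_cell {n k : ℕ} (hk : k < n + 1) : IntervalIntegrable φ volume
    ((k : ℝ) / ((n : ℝ) + 1)) (((k + 1 : ℕ) : ℝ) / ((n : ℝ) + 1)) := by
  refine hint.mono_set (Set.uIcc_subset_uIcc ?_ ?_) <;> rw [Set.uIcc_of_le zero_le_one]
  · exact div_mem_Icc hk.le
  · exact div_mem_Icc hk

theorem mem_Ioo_of_mem_cell {n k : ℕ} (hk : k < n + 1) {t : ℝ}
    (ht : t ∈ Set.Ioo ((k : ℝ) / ((n : ℝ) + 1)) (((k + 1 : ℕ) : ℝ) / ((n : ℝ) + 1))) :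
    t ∈ Set.Ioo (0 : ℝ) 1 :=
  ⟨(div_mem_Icc (k := k) hk.le).1.trans_lt ht.1, ht.2.trans_le (div_mem_Icc (k := k + 1) hk).2⟩

include hint hpos in
theorem cellMass_pos {n k : ℕ} (hk : k < n + 1) : 0 < cellMass φ n k :=
  intervalIntegral.intervalIntegral_pos_of_pos_on (intervalIntegrable_cell hint hk)
    (fun t ht => hpos t (mem_Ioo_of_mem_cell hk ht)) (div_lt_succ_div k n)

include hint hmono in
theorem cellMass_le_succ {n k : ℕ} (hk : k < n) : cellMass φ n k ≤ cellMass φ n (k + 1) := by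
  have e1 : ((k + 1 : ℕ) : ℝ) / ((n : ℝ) + 1) = (k : ℝ) / ((n : ℝ) + 1) + 1 / ((n : ℝ) + 1) := by
    push_cast; ring
  have e2 : ((k + 1 + 1 : ℕ) : ℝ) / ((n : ℝ) + 1)
      = ((k + 1 : ℕ) : ℝ) / ((n : ℝ) + 1) + 1 / ((n : ℝ) + 1) := by
    push_cast; ring
  have hi := intervalIntegrable_cell hint (show k + 1 < n + 1 by omega)
  have hshift : cellMass φ n (k + 1) = ∫ t in ((k : ℝ) / ((n : ℝ) + 1))..
      (((k + 1 : ℕ) : ℝ) / ((n : ℝ) + 1)), φ (t + 1 / ((n : ℝ) + 1)) := by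
    rw [intervalIntegral.integral_comp_add_right, ← e1, ← e2, cellMass]
  rw [hshift, cellMass]
  refine intervalIntegral.integral_mono_on_of_le_Ioo (div_lt_succ_div k n).le
    (intervalIntegrable_cell hint (by omega)) ?_ ?_
  · rw [e2] at hi
    nth_rewrite 1 [e1] at hi
    exact (IntervalIntegrable.comp_add_right_iff).2 hi
  · intro t ht
    have hd : (0 : ℝ) < 1 / ((n : ℝ) + 1) := by positivity
    refine hmono (mem_Ioo_of_mem_cell (by omega) ht)
      (mem_Ioo_of_mem_cell (show k + 1 < n + 1 by omega) ⟨?_, ?_⟩) (by linarith)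
    · rw [e1]; linarith [ht.1]
    · rw [e2]; linarith [ht.2]

include hint in
theorem sum_cellMass (n : ℕ) : ∑ k ∈ Finset.range (n + 1), cellMass φ n k = ∫ t in (0 : ℝ)..1, φ t := by
  have h := intervalIntegral.sum_integral_adjacent_intervals (f := φ) (μ := volume)
    (a := fun k : ℕ => (k : ℝ) / ((n : ℝ) + 1)) (n := n + 1)
    (fun k hk => intervalIntegrable_cell hint hk)
  simp only [cellMass]
  rw [h]
  have : (n : ℝ) + 1 ≠ 0 := by positivity
  simp [this]

include hint in
theorem sum_cellMass_mul (n : ℕ) (g : ℕ → ℝ) :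
    ∑ k ∈ Finset.range (n + 1), cellMass φ n k * g (k + 1)
      = ∫ t in (0 : ℝ)..1, φ t * g ⌈t * ((n : ℝ) + 1)⌉₊ := by
  have hN : (0 : ℝ) < (n : ℝ) + 1 := by positivity
  have hcongr : ∀ k : ℕ, Set.EqOn (fun t => φ t * g (k + 1))
      (fun t => φ t * g ⌈t * ((n : ℝ) + 1)⌉₊)
      (Set.uIoc ((k : ℝ) / ((n : ℝ) + 1)) (((k + 1 : ℕ) : ℝ) / ((n : ℝ) + 1))) := by
    intro k t ht
    rw [Set.uIoc_of_le (div_lt_succ_div k n).le] at ht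
    have : ⌈t * ((n : ℝ) + 1)⌉₊ = k + 1 := by
      rw [Nat.ceil_eq_iff (by omega)]
      constructor
      · simpa using (div_lt_iff₀ hN).1 ht.1
      · exact (le_div_iff₀ hN).1 ht.2
    simp only [this]
  have h := intervalIntegral.sum_integral_adjacent_intervals
    (f := fun t => φ t * g ⌈t * ((n : ℝ) + 1)⌉₊) (μ := volume)
    (a := fun k : ℕ => (k : ℝ) / ((n : ℝ) + 1)) (n := n + 1)
    (fun k hk => (intervalIntegrable_congr (hcongr k)).1
      ((intervalIntegrable_cell hint hk).mul_const _))
  have e : ∀ k, cellMass φ n k * g (k + 1) = ∫ t in ((k : ℝ) / ((n : ℝ) + 1))..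
      (((k + 1 : ℕ) : ℝ) / ((n : ℝ) + 1)), φ t * g ⌈t * ((n : ℝ) + 1)⌉₊ := by
    intro k
    rw [cellMass, ← intervalIntegral.integral_mul_const]
    exact intervalIntegral.integral_congr_ae (Eventually.of_forall fun t ht => hcongr k ht)
  simp only [e]
  rw [h]
  have : (n : ℝ) + 1 ≠ 0 := by positivity
  simp [this]

theorem choose_div_pow_le {m n : ℕ} (hm : m ≤ n + 1) (j : ℕ) :
    ((m + j).choose (2 * j + 1) : ℝ) / ((n : ℝ) + 1) ^ (2 * j + 1)
      ≤ 1 / ((2 * j + 1).factorial : ℝ) := by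
  rw [cast_choose_eq, div_div, div_le_div_iff₀ (by positivity) (by positivity), one_mul]
  have h1 := cast_descFactorial_le m j
  have h2 : (m : ℝ) ^ (2 * j + 1) ≤ ((n : ℝ) + 1) ^ (2 * j + 1) :=
    pow_le_pow_left₀ (by positivity) (by exact_mod_cast hm) _
  rw [mul_comm ((2 * j + 1).factorial : ℝ)]
  exact mul_le_mul_of_nonneg_right (h1.trans h2) (by positivity)

include hint hpos in
theorem abs_coeff_sinApprox_le (n j : ℕ) :
    |(sinApprox φ n).coeff j| ≤ (∫ t in (0 : ℝ)..1, φ t) / ((2 * j + 1).factorial : ℝ) := by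
  rw [coeff_sinApprox, abs_mul, abs_pow, abs_neg, abs_one, one_pow, one_mul, abs_of_nonneg,
    ← sum_cellMass hint n, Finset.sum_div]
  · refine Finset.sum_le_sum fun k hk => ?_
    have hk := Finset.mem_range.1 hk
    rw [div_eq_mul_one_div (cellMass φ n k)]
    exact mul_le_mul_of_nonneg_left (choose_div_pow_le hk j) (cellMass_pos hint hpos hk).le
  · exact Finset.sum_nonneg fun k hk => mul_nonneg
      (cellMass_pos hint hpos (Finset.mem_range.1 hk)).le (by positivity)

include hint in
theorem tendsto_coeff_sinApprox (j : ℕ) :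
    Tendsto (fun n => (sinApprox φ n).coeff j) atTop
      (𝓝 ((-1) ^ j * (∫ t in (0 : ℝ)..1, φ t * t ^ (2 * j + 1)) / ((2 * j + 1).factorial : ℝ))) := by
  have hmeas : ∀ n : ℕ, Measurable fun t : ℝ =>
      ((⌈t * ((n : ℝ) + 1)⌉₊ + j).choose (2 * j + 1) : ℝ) / ((n : ℝ) + 1) ^ (2 * j + 1) := by
    intro n
    have h1 : Measurable fun t : ℝ => ⌈t * ((n : ℝ) + 1)⌉₊ :=
      Nat.measurable_ceil.comp (measurable_id.mul_const _)
    exact (measurable_from_nat (f := fun m : ℕ =>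
      ((m + j).choose (2 * j + 1) : ℝ) / ((n : ℝ) + 1) ^ (2 * j + 1))).comp h1
  have hI : Tendsto (fun n : ℕ => ∫ t in (0 : ℝ)..1, φ t *
      (((⌈t * ((n : ℝ) + 1)⌉₊ + j).choose (2 * j + 1) : ℝ) / ((n : ℝ) + 1) ^ (2 * j + 1))) atTop
      (𝓝 (∫ t in (0 : ℝ)..1, φ t * (t ^ (2 * j + 1) / ((2 * j + 1).factorial : ℝ)))) := by
    refine intervalIntegral.tendsto_integral_filter_of_dominated_convergence
      (fun t => |φ t| * (1 / ((2 * j + 1).factorial : ℝ))) (Eventually.of_forall fun n => ?_)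
      (Eventually.of_forall fun n => Eventually.of_forall fun t ht => ?_)
      (hint.abs.mul_const _) (Eventually.of_forall fun t ht => ?_)
    · exact hint.def'.aestronglyMeasurable.mul (hmeas n).aestronglyMeasurable
    · rw [Set.uIoc_of_le zero_le_one] at ht
      rw [norm_mul, Real.norm_eq_abs, Real.norm_of_nonneg (by positivity)]
      refine mul_le_mul_of_nonneg_left (choose_div_pow_le (Nat.ceil_le.2 ?_) j) (abs_nonneg _)
      push_cast
      have : (0 : ℝ) < (n : ℝ) + 1 := by positivity
      nlinarith [ht.2]
    · rw [Set.uIoc_of_le zero_le_one] at ht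
      refine Tendsto.const_mul _ ?_
      have h1 : Tendsto (fun n : ℕ => (⌈t * ((n : ℝ) + 1)⌉₊ : ℝ) / ((n : ℝ) + 1)) atTop (𝓝 t) :=
        (tendsto_nat_ceil_mul_div_atTop ht.1.le).comp
          (tendsto_natCast_atTop_atTop.atTop_add tendsto_const_nhds)
      refine ((tendsto_descFactorial_div t _ h1 j).div_const _).congr fun n => ?_
      rw [cast_choose_eq, div_right_comm]
  have hlim : (-1 : ℝ) ^ j * (∫ t in (0 : ℝ)..1, φ t * t ^ (2 * j + 1)) / ((2 * j + 1).factorial : ℝ)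
      = (-1) ^ j * ∫ t in (0 : ℝ)..1, φ t * (t ^ (2 * j + 1) / ((2 * j + 1).factorial : ℝ)) := by
    rw [mul_div_assoc, ← intervalIntegral.integral_div]
    simp only [mul_div_assoc]
  rw [hlim]
  refine (hI.const_mul ((-1 : ℝ) ^ j)).congr fun n => ?_
  rw [coeff_sinApprox, sum_cellMass_mul hint n fun m =>
    ((m + j).choose (2 * j + 1) : ℝ) / ((n : ℝ) + 1) ^ (2 * j + 1)]

include hint hmono hpos in
theorem im_eq_zero_and_re_pos_of_aeval_sinApprox (n : ℕ) {z : ℂ}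
    (hz : aeval z (sinApprox φ n) = 0) : z.im = 0 ∧ 0 < z.re := by
  have hN : (0 : ℝ) < (n : ℝ) + 1 := by positivity
  set b : ℝ := (((n : ℝ) + 1) ^ 2)⁻¹ with hb
  have hbpos : 0 < b := by positivity
  have h1 : aeval ((b : ℂ) * z)
      (∑ k ∈ Finset.range (n + 1), C (cellMass φ n k) * sinQuot (k + 1)) = 0 := by
    rw [sinApprox, map_mul, aeval_comp, map_mul, aeval_C, aeval_C, aeval_X] at hz
    refine (mul_eq_zero.1 hz).resolve_left ?_
    rw [Complex.coe_algebraMap]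
    exact_mod_cast (inv_pos.2 hN).ne'
  have h2 := im_eq_zero_and_re_pos_of_aeval_sum_sinQuot
    (cellMass_pos hint hpos (Nat.succ_pos n)).le (fun k hk => cellMass_le_succ hint hmono hk)
    (cellMass_pos hint hpos (Nat.lt_succ_self n)) h1
  rw [Complex.im_ofReal_mul, Complex.re_ofReal_mul] at h2
  exact ⟨(mul_eq_zero.1 h2.1).resolve_left hbpos.ne', pos_of_mul_pos_right h2.2 hbpos.le⟩

end Weight

/-! ### Power series of finite sine transforms -/

/-- The coefficients of the power series `∑ sinCoeff φ j * z ^ (2 j + 1)` of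
`z ↦ ∫ t in 0..1, φ t * sin (z t)`. -/
noncomputable def sinCoeff (φ : ℝ → ℝ) (j : ℕ) : ℝ :=
  (-1) ^ j * (∫ t in (0 : ℝ)..1, φ t * t ^ (2 * j + 1)) / ((2 * j + 1).factorial : ℝ)

section Weight

variable {φ : ℝ → ℝ} (hint : IntervalIntegrable φ volume 0 1)
  (hmono : MonotoneOn φ (Set.Ioo 0 1)) (hpos : ∀ t ∈ Set.Ioo (0 : ℝ) 1, 0 < φ t)

include hint hpos in
theorem abs_sinCoeff_le (j : ℕ) :
    |sinCoeff φ j| ≤ (∫ t in (0 : ℝ)..1, φ t) / ((2 * j + 1).factorial : ℝ) :=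
  le_of_tendsto (tendsto_coeff_sinApprox hint j).abs
    (Eventually.of_forall fun n => abs_coeff_sinApprox_le hint hpos n j)

include hint hpos in
theorem integral_weight_pos : 0 < ∫ t in (0 : ℝ)..1, φ t :=
  intervalIntegral.intervalIntegral_pos_of_pos_on hint hpos zero_lt_one

include hint hpos in
theorem sinCoeff_zero_pos : 0 < sinCoeff φ 0 := by
  have : 0 < ∫ t in (0 : ℝ)..1, φ t * t :=
    intervalIntegral.intervalIntegral_pos_of_pos_on
      (hint.mul_continuousOn continuous_id.continuousOn)
      (fun t ht => mul_pos (hpos t ht) ht.1) zero_lt_one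
  simpa [sinCoeff] using this

theorem add_mul_div_factorial_le {a I : ℝ} (ha : 0 < a) (hI : 0 ≤ I) (j : ℕ) :
    (a + 2 * (j : ℝ)) * (I / ((2 * j + 1).factorial : ℝ)) ≤ (a + 1) * I / (j.factorial : ℝ) := by
  have h1 : (j.factorial : ℝ) ≤ ((2 * j).factorial : ℝ) := by
    exact_mod_cast Nat.factorial_le (by omega)
  have h2 : (0 : ℝ) < j.factorial := by positivity
  rw [Nat.factorial_succ, mul_div_assoc', div_le_div_iff₀ (by positivity) h2]
  push_cast
  have h3 : a + 2 * (j : ℝ) ≤ (a + 1) * (2 * j + 1) := by nlinarith [mul_nonneg ha.le j.cast_nonneg]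
  calc (a + 2 * (j : ℝ)) * I * j.factorial
      ≤ ((a + 1) * (2 * j + 1)) * I * ((2 * j).factorial : ℝ) := by gcongr
    _ = _ := by ring

/-- The polynomials `a p + 2 x p'` for the sine approximants `p` are, up to their constant terms,
products `∏ (1 - y x)` with all `y > 0`, and their coefficients converge to those of
`∑ (a + 2 j) sinCoeff φ j x ^ j` under a bound summable against every geometric sequence. -/
theorem exists_prodOneSub_tendsto (hint : IntervalIntegrable φ volume 0 1)
    (hmono : MonotoneOn φ (Set.Ioo 0 1)) (hpos : ∀ t ∈ Set.Ioo (0 : ℝ) 1, 0 < φ t)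
    {a : ℝ} (ha : 0 < a) :
    ∃ (Y : ℕ → Multiset ℝ) (K : ℝ), (∀ n, ∀ y ∈ Y n, 0 < y) ∧
      (∀ j, Tendsto (fun n => (prodOneSub (Y n)).coeff j) atTop
        (𝓝 ((a + 2 * (j : ℝ)) * sinCoeff φ j / (a * sinCoeff φ 0)))) ∧
      ∀ᶠ n in atTop, ∀ j : ℕ, |(prodOneSub (Y n)).coeff j| ≤ K / (j.factorial : ℝ) := by
  set Q : ℕ → ℝ[X] := fun n => C a * sinApprox φ n + 2 * X * derivative (sinApprox φ n)
  have hQ : ∀ n j, (Q n).coeff j = (a + 2 * (j : ℝ)) * (sinApprox φ n).coeff j := by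
    intro n j
    have h2 : (2 : ℝ[X]) = C 2 := (map_ofNat C 2).symm
    rcases j with _ | j
    · simp [Q]
    · simp only [Q, coeff_add, coeff_C_mul, h2, mul_assoc, coeff_X_mul, coeff_derivative]
      push_cast
      ring
  choose Y hY hYQ using fun n => exists_eq_C_mul_prodOneSub (p := Q n) fun z hz =>
    im_eq_zero_and_re_pos_of_aeval_add_derivative
      (fun w hw => im_eq_zero_and_re_pos_of_aeval_sinApprox hint hmono hpos n hw) ha hz
  have hd0 := sinCoeff_zero_pos hint hpos
  have hI := (integral_weight_pos hint hpos).le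
  set I := ∫ t in (0 : ℝ)..1, φ t
  have ht0 : Tendsto (fun n => (sinApprox φ n).coeff 0) atTop (𝓝 (sinCoeff φ 0)) :=
    tendsto_coeff_sinApprox hint 0
  have hev : ∀ᶠ n in atTop, sinCoeff φ 0 / 2 < (sinApprox φ n).coeff 0 :=
    ht0.eventually (lt_mem_nhds (by linarith))
  have hcoeff : ∀ n, 0 < (sinApprox φ n).coeff 0 → ∀ j, (prodOneSub (Y n)).coeff j
      = (a + 2 * (j : ℝ)) * (sinApprox φ n).coeff j / (a * (sinApprox φ n).coeff 0) := by
    intro n hn j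
    have h0 : (Q n).coeff 0 = a * (sinApprox φ n).coeff 0 := by rw [hQ]; simp
    have h1 : (Q n).coeff j = (Q n).coeff 0 * (prodOneSub (Y n)).coeff j := by
      conv_lhs => rw [hYQ n]
      rw [coeff_C_mul]
    rw [hQ, h0] at h1
    rw [h1, mul_div_cancel_left₀]
    positivity
  refine ⟨Y, (a + 1) * I / (a * (sinCoeff φ 0 / 2)), hY, fun j => ?_, ?_⟩
  · refine Tendsto.congr' (hev.mono fun n hn => (hcoeff n (by linarith) j).symm) ?_
    exact ((tendsto_coeff_sinApprox hint j).const_mul _).div (ht0.const_mul a) (by positivity)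
  · filter_upwards [hev] with n hn j
    have hn0 : 0 < (sinApprox φ n).coeff 0 := by linarith
    rw [hcoeff n hn0 j, abs_div, abs_mul, abs_of_pos (show 0 < a + 2 * (j : ℝ) by positivity),
      abs_of_pos (show 0 < a * (sinApprox φ n).coeff 0 by positivity), div_right_comm]
    have h1 : (a + 2 * (j : ℝ)) * |(sinApprox φ n).coeff j| ≤ (a + 1) * I / (j.factorial : ℝ) :=
      (mul_le_mul_of_nonneg_left (abs_coeff_sinApprox_le hint hpos n j) (by positivity)).trans
        (add_mul_div_factorial_le ha hI j)
    refine div_le_div₀ (by positivity) h1 (by positivity) ?_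
    exact mul_le_mul_of_nonneg_left hn.le ha.le

theorem summable_div_factorial_mul_pow (K R : ℝ) :
    Summable fun j : ℕ => K / (j.factorial : ℝ) * R ^ j := by
  refine ((Real.summable_pow_div_factorial R).mul_left K).congr fun j => ?_
  ring

include hint hpos in
theorem summable_sinCoeff (z : ℝ) : Summable fun j : ℕ => sinCoeff φ j * z ^ (2 * j + 1) := by
  have hI := (integral_weight_pos hint hpos).le
  refine .of_norm_bounded
    ((summable_div_factorial_mul_pow ((1 + 1) * ∫ t in (0 : ℝ)..1, φ t) (z ^ 2)).mul_right |z|)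
    fun j => ?_
  rw [norm_mul, norm_pow, Real.norm_eq_abs, Real.norm_eq_abs, pow_succ, pow_mul, sq_abs, ← mul_assoc]
  refine mul_le_mul_of_nonneg_right (mul_le_mul_of_nonneg_right ?_ (by positivity)) (abs_nonneg z)
  refine le_trans ?_ (add_mul_div_factorial_le one_pos hI j)
  have h := abs_sinCoeff_le hint hpos j
  have h0 : 0 ≤ (∫ t in (0 : ℝ)..1, φ t) / ((2 * j + 1).factorial : ℝ) := by positivity
  nlinarith [mul_nonneg (Nat.cast_nonneg (α := ℝ) j) h0]

include hint in
theorem hasSum_sinCoeff (z : ℝ) : HasSum (fun j : ℕ => sinCoeff φ j * z ^ (2 * j + 1))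
    (∫ t in (0 : ℝ)..1, φ t * Real.sin (z * t)) := by
  have h := intervalIntegral.hasSum_integral_of_dominated_convergence (μ := volume)
    (a := 0) (b := 1)
    (F := fun (j : ℕ) t => φ t * ((-1) ^ j * (z * t) ^ (2 * j + 1) / ((2 * j + 1).factorial : ℝ)))
    (f := fun t => φ t * Real.sin (z * t))
    (fun j t => |φ t| * (|z| ^ (2 * j + 1) / ((2 * j + 1).factorial : ℝ)))
    (fun j => hint.def'.aestronglyMeasurable.mul (by fun_prop))
    (fun j => Eventually.of_forall fun t ht => by
      rw [Set.uIoc_of_le zero_le_one] at ht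
      rw [norm_mul, norm_div, norm_mul, norm_pow, norm_pow, norm_neg, norm_one, one_pow, one_mul,
        Real.norm_eq_abs, Real.norm_eq_abs, Real.norm_of_nonneg (by positivity), abs_mul]
      gcongr
      rw [abs_of_pos ht.1]
      exact mul_le_of_le_one_right (abs_nonneg z) ht.2)
    (Eventually.of_forall fun t _ =>
      ((Real.summable_pow_div_factorial |z|).comp_injective
        (fun i j h => by simpa using h : Function.Injective fun j : ℕ => 2 * j + 1)).mul_left _)
    (by
      simp only [tsum_mul_left]
      exact hint.abs.mul_const _)
    (Eventually.of_forall fun t _ => (Real.hasSum_sin (z * t)).mul_left _)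
  refine h.congr_fun fun j => ?_
  rw [sinCoeff, mul_div_assoc, mul_assoc, ← intervalIntegral.integral_div,
    ← intervalIntegral.integral_mul_const, ← intervalIntegral.integral_const_mul]
  refine intervalIntegral.integral_congr fun t _ => ?_
  simp only [mul_pow]
  ring

end Weight

/-! ### Sign changes and Euler-Rayleigh bounds for sine transforms -/

section Weight

variable {φ : ℝ → ℝ} (hint : IntervalIntegrable φ volume 0 1)
  (hmono : MonotoneOn φ (Set.Ioo 0 1)) (hpos : ∀ t ∈ Set.Ioo (0 : ℝ) 1, 0 < φ t)

theorem integral_sin_mul {ω : ℝ} (hω : ω ≠ 0) (u v : ℝ) :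
    ∫ t in u..v, Real.sin (ω * t) = (Real.cos (ω * u) - Real.cos (ω * v)) / ω := by
  rw [intervalIntegral.integral_comp_mul_left (fun t => Real.sin t) hω, integral_sin, smul_eq_mul]
  ring

include hint in
theorem intervalIntegrable_mul_sin {u v : ℝ} (hu : u ∈ Set.Icc (0 : ℝ) 1)
    (hv : v ∈ Set.Icc (0 : ℝ) 1) (ω : ℝ) :
    IntervalIntegrable (fun t => φ t * Real.sin (ω * t)) volume u v := by
  refine IntervalIntegrable.mul_continuousOn (hint.mono_set (Set.uIcc_subset_uIcc ?_ ?_))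
    (by fun_prop) <;> rwa [Set.uIcc_of_le zero_le_one]

include hint in
/-- Comparison of `φ` with a constant `c` on an interval on which `φ - c` and the sine have the
same sign. -/
theorem mul_integral_sin_lt {u v : ℝ} (hu : u ∈ Set.Icc (0 : ℝ) 1) (hv : v ∈ Set.Icc (0 : ℝ) 1)
    (huv : u < v) {ω c : ℝ}
    (h : ∀ t ∈ Set.Ioo u v, 0 < (φ t - c) * Real.sin (ω * t)) :
    c * ∫ t in u..v, Real.sin (ω * t) < ∫ t in u..v, φ t * Real.sin (ω * t) := by
  have h1 := intervalIntegrable_mul_sin hint hu hv ω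
  have h2 : IntervalIntegrable (fun t => c * Real.sin (ω * t)) volume u v :=
    Continuous.intervalIntegrable (by fun_prop) u v
  have h3 := intervalIntegral.intervalIntegral_pos_of_pos_on (h1.sub h2)
    (fun t ht => by have := h t ht; linarith) huv
  rw [intervalIntegral.integral_sub h1 h2, intervalIntegral.integral_const_mul] at h3
  linarith

include hint in
theorem lt_mul_integral_sin {u v : ℝ} (hu : u ∈ Set.Icc (0 : ℝ) 1) (hv : v ∈ Set.Icc (0 : ℝ) 1)
    (huv : u < v) {ω c : ℝ}
    (h : ∀ t ∈ Set.Ioo u v, (φ t - c) * Real.sin (ω * t) < 0) :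
    ∫ t in u..v, φ t * Real.sin (ω * t) < c * ∫ t in u..v, Real.sin (ω * t) := by
  have := mul_integral_sin_lt (φ := fun t => -φ t) hint.neg hu hv huv (ω := ω) (c := -c)
    fun t ht => by have := h t ht; linarith
  simp only [neg_mul, intervalIntegral.integral_neg] at this
  linarith

include hint hpos in
theorem integral_mul_sin_pi_pos : 0 < ∫ t in (0 : ℝ)..1, φ t * Real.sin (Real.pi * t) := by
  refine intervalIntegral.intervalIntegral_pos_of_pos_on
    (intervalIntegrable_mul_sin hint (by simp) (by simp) _) (fun t ht => ?_) zero_lt_one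
  have := Real.pi_pos
  exact mul_pos (hpos t ht) (Real.sin_pos_of_pos_of_lt_pi (by nlinarith [ht.1]) (by nlinarith [ht.2]))

/-- Over one full period the larger weights meet the negative half-wave. -/
theorem integral_mul_sin_two_pi_neg (hint : IntervalIntegrable φ volume 0 1)
    (hmono : StrictMonoOn φ (Set.Ioo 0 1)) :
    ∫ t in (0 : ℝ)..1, φ t * Real.sin (2 * Real.pi * t) < 0 := by
  have hπ := Real.pi_pos
  have hhalf : (1 / 2 : ℝ) ∈ Set.Ioo (0 : ℝ) 1 := by constructor <;> norm_num
  have hc := Set.Ioo_subset_Icc_self hhalf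
  have h1 := lt_mul_integral_sin hint (u := 0) (v := 1 / 2) (by simp) hc (by norm_num)
    (ω := 2 * Real.pi) (c := φ (1 / 2)) fun t ht => by
      have h := hmono ⟨ht.1, ht.2.trans hhalf.2⟩ hhalf ht.2
      exact mul_neg_of_neg_of_pos (by linarith)
        (Real.sin_pos_of_pos_of_lt_pi (by nlinarith [ht.1]) (by nlinarith [ht.2]))
  have h2 := lt_mul_integral_sin hint (u := 1 / 2) (v := 1) hc (by simp) (by norm_num)
    (ω := 2 * Real.pi) (c := φ (1 / 2)) fun t ht => by
      have h := hmono hhalf ⟨hhalf.1.trans ht.1, ht.2⟩ ht.1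
      have hs : 0 < Real.sin (2 * Real.pi * t - Real.pi) :=
        Real.sin_pos_of_pos_of_lt_pi (by nlinarith [ht.1]) (by nlinarith [ht.2])
      rw [Real.sin_sub_pi] at hs
      exact mul_neg_of_pos_of_neg (by linarith) (by linarith)
  rw [integral_sin_mul (by positivity)] at h1 h2
  have h3 := intervalIntegral.integral_add_adjacent_intervals
    (intervalIntegrable_mul_sin hint (u := 0) (v := 1 / 2) (by simp) hc (2 * Real.pi))
    (intervalIntegrable_mul_sin hint (u := 1 / 2) (v := 1) hc (by simp) (2 * Real.pi))
  rw [← h3]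
  have e1 : Real.cos (2 * Real.pi * (1 / 2)) = -1 := by
    rw [show 2 * Real.pi * (1 / 2) = Real.pi by ring, Real.cos_pi]
  have e2 : Real.cos (2 * Real.pi * 1) = 1 := by rw [mul_one, Real.cos_two_pi]
  rw [e1, mul_zero, Real.cos_zero] at h1
  rw [e1, e2] at h2
  have e3 : φ (1 / 2) * ((1 - -1) / (2 * Real.pi)) + φ (1 / 2) * ((-1 - 1) / (2 * Real.pi)) = 0 := by
    ring
  linarith

/-- Over three half-periods the first half-wave contributes a positive amount, and in the remaining
full period the larger weights meet the positive half-wave. -/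
theorem integral_mul_sin_three_pi_pos (hint : IntervalIntegrable φ volume 0 1)
    (hmono : StrictMonoOn φ (Set.Ioo 0 1)) (hpos : ∀ t ∈ Set.Ioo (0 : ℝ) 1, 0 < φ t) :
    0 < ∫ t in (0 : ℝ)..1, φ t * Real.sin (3 * Real.pi * t) := by
  have hπ := Real.pi_pos
  have ha : (1 / 3 : ℝ) ∈ Set.Ioo (0 : ℝ) 1 := by constructor <;> norm_num
  have hb : (2 / 3 : ℝ) ∈ Set.Ioo (0 : ℝ) 1 := by constructor <;> norm_num
  have ha' := Set.Ioo_subset_Icc_self ha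
  have hb' := Set.Ioo_subset_Icc_self hb
  have h0 := mul_integral_sin_lt hint (u := 0) (v := 1 / 3) (by simp) ha' (by norm_num)
    (ω := 3 * Real.pi) (c := 0) fun t ht => by
      have h := hpos t ⟨ht.1, ht.2.trans ha.2⟩
      exact mul_pos (by linarith)
        (Real.sin_pos_of_pos_of_lt_pi (by nlinarith [ht.1]) (by nlinarith [ht.2]))
  have h1 := mul_integral_sin_lt hint (u := 1 / 3) (v := 2 / 3) ha' hb' (by norm_num)
    (ω := 3 * Real.pi) (c := φ (2 / 3)) fun t ht => by
      have h := hmono ⟨ha.1.trans ht.1, ht.2.trans hb.2⟩ hb ht.2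
      have hs : 0 < Real.sin (3 * Real.pi * t - Real.pi) :=
        Real.sin_pos_of_pos_of_lt_pi (by nlinarith [ht.1]) (by nlinarith [ht.2])
      rw [Real.sin_sub_pi] at hs
      exact mul_pos_of_neg_of_neg (by linarith) (by linarith)
  have h2 := mul_integral_sin_lt hint (u := 2 / 3) (v := 1) hb' (by simp) (by norm_num)
    (ω := 3 * Real.pi) (c := φ (2 / 3)) fun t ht => by
      have h := hmono hb ⟨hb.1.trans ht.1, ht.2⟩ ht.1
      have hs : 0 < Real.sin (3 * Real.pi * t - 2 * Real.pi) :=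
        Real.sin_pos_of_pos_of_lt_pi (by nlinarith [ht.1]) (by nlinarith [ht.2])
      rw [Real.sin_sub_two_pi] at hs
      exact mul_pos (by linarith) hs
  rw [integral_sin_mul (by positivity)] at h1 h2
  have h3 := intervalIntegral.integral_add_adjacent_intervals
    (intervalIntegrable_mul_sin hint (u := 0) (v := 1 / 3) (by simp) ha' (3 * Real.pi))
    (intervalIntegrable_mul_sin hint (u := 1 / 3) (v := 1) ha' (by simp) (3 * Real.pi))
  have h4 := intervalIntegral.integral_add_adjacent_intervals
    (intervalIntegrable_mul_sin hint (u := 1 / 3) (v := 2 / 3) ha' hb' (3 * Real.pi))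
    (intervalIntegrable_mul_sin hint (u := 2 / 3) (v := 1) hb' (by simp) (3 * Real.pi))
  rw [← h3, ← h4]
  have e1 : Real.cos (3 * Real.pi * (1 / 3)) = -1 := by
    rw [show 3 * Real.pi * (1 / 3) = Real.pi by ring, Real.cos_pi]
  have e2 : Real.cos (3 * Real.pi * (2 / 3)) = 1 := by
    rw [show 3 * Real.pi * (2 / 3) = 2 * Real.pi by ring, Real.cos_two_pi]
  have e3 : Real.cos (3 * Real.pi * 1) = -1 := by
    rw [show 3 * Real.pi * 1 = Real.pi + 2 * Real.pi by ring, Real.cos_add_two_pi, Real.cos_pi]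
  rw [zero_mul] at h0
  rw [e1, e2] at h1
  rw [e2, e3] at h2
  have e4 : φ (2 / 3) * ((-1 - 1) / (3 * Real.pi)) + φ (2 / 3) * ((1 - -1) / (3 * Real.pi)) = 0 := by
    ring
  linarith

include hint hpos in
theorem hasDerivAt_tsum_sinCoeff {z : ℝ} (hz : 0 < z) :
    HasDerivAt (fun x => ∑' j : ℕ, sinCoeff φ j * x ^ (2 * j + 1))
      (∑' j : ℕ, sinCoeff φ j * (((2 * j + 1 : ℕ) : ℝ) * z ^ (2 * j))) z := by
  have hI := (integral_weight_pos hint hpos).le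
  refine hasDerivAt_tsum_of_isPreconnected
    (u := fun j : ℕ => ((1 + 1) * ∫ t in (0 : ℝ)..1, φ t) / (j.factorial : ℝ) * ((z + 1) ^ 2) ^ j)
    (g := fun (j : ℕ) (x : ℝ) => sinCoeff φ j * x ^ (2 * j + 1))
    (g' := fun (j : ℕ) (x : ℝ) => sinCoeff φ j * (((2 * j + 1 : ℕ) : ℝ) * x ^ (2 * j)))
    (t := Set.Ioo 0 (z + 1)) (y₀ := z)
    (summable_div_factorial_mul_pow _ _) isOpen_Ioo isPreconnected_Ioo (fun j x _ => ?_)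
    (fun j x hx => ?_) ⟨hz, by linarith⟩ (summable_sinCoeff hint hpos z) ⟨hz, by linarith⟩
  · exact (hasDerivAt_pow (2 * j + 1) x).const_mul _
  · rw [norm_mul, norm_mul, norm_pow, Real.norm_eq_abs, Real.norm_eq_abs, Real.norm_eq_abs,
      abs_of_pos hx.1, Nat.abs_cast, pow_mul, ← mul_assoc]
    have h1 : (x ^ 2) ^ j ≤ ((z + 1) ^ 2) ^ j :=
      pow_le_pow_left₀ (sq_nonneg x) (pow_le_pow_left₀ hx.1.le hx.2.le 2) j
    refine mul_le_mul ?_ h1 (by positivity) (by positivity)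
    refine le_trans ?_ (add_mul_div_factorial_le one_pos hI j)
    have h := mul_le_mul_of_nonneg_left (abs_sinCoeff_le hint hpos j)
      (show (0 : ℝ) ≤ 1 + 2 * (j : ℝ) by positivity)
    push_cast
    linarith

include hint hpos in
theorem hasDerivAt_rpow_mul_tsum_sinCoeff (a : ℝ) {z : ℝ} (hz : 0 < z) :
    HasDerivAt (fun x => x ^ (a - 1) * ∑' j : ℕ, sinCoeff φ j * x ^ (2 * j + 1))
      (z ^ (a - 1) * ∑' j : ℕ, (a + 2 * (j : ℝ)) * sinCoeff φ j * (z ^ 2) ^ j) z := by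
  have h := (Real.hasDerivAt_rpow_const (p := a - 1) (Or.inl hz.ne')).mul
    (hasDerivAt_tsum_sinCoeff hint hpos hz)
  refine h.congr_deriv ?_
  have hz1 : z ^ (a - 1) = z ^ (a - 1 - 1) * z := by
    rw [Real.rpow_sub_one hz.ne' (a - 1), div_mul_cancel₀ _ hz.ne']
  have hs1 := summable_sinCoeff hint hpos z
  have hs2 : Summable fun j : ℕ => (a + 2 * (j : ℝ)) * sinCoeff φ j * (z ^ 2) ^ j := by
    have hI := (integral_weight_pos hint hpos).le
    refine .of_norm_bounded
      (summable_div_factorial_mul_pow ((|a| + 1 + 1) * ∫ t in (0 : ℝ)..1, φ t) (z ^ 2)) fun j => ?_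
    rw [norm_mul, norm_pow, norm_mul, Real.norm_eq_abs, Real.norm_eq_abs, Real.norm_eq_abs,
      abs_of_nonneg (sq_nonneg z)]
    refine mul_le_mul_of_nonneg_right ?_ (by positivity)
    refine le_trans ?_ (add_mul_div_factorial_le (show 0 < |a| + 1 by positivity) hI j)
    refine mul_le_mul ?_ (abs_sinCoeff_le hint hpos j) (abs_nonneg _) (by positivity)
    refine (abs_add_le _ _).trans ?_
    rw [abs_of_nonneg (show (0 : ℝ) ≤ 2 * j by positivity)]
    linarith
  have hterm : ∀ j : ℕ, sinCoeff φ j * (((2 * j + 1 : ℕ) : ℝ) * z ^ (2 * j))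
      = (a + 2 * (j : ℝ)) * sinCoeff φ j * (z ^ 2) ^ j
        - (a - 1) * z⁻¹ * (sinCoeff φ j * z ^ (2 * j + 1)) := by
    intro j
    rw [← pow_mul, pow_succ]
    push_cast
    field_simp
    ring
  simp only [hterm]
  rw [hs2.tsum_sub (hs1.mul_left _), tsum_mul_left, hz1]
  field_simp
  ring

/-- Rolle's argument: `x ^ (a - 1) * ∫ φ t * sin (x t)` is positive at `π`, negative at `2 π` and
positive at `3 π`, so its derivative takes both signs. -/
theorem exists_sign_change (hint : IntervalIntegrable φ volume 0 1)
    (hmono : StrictMonoOn φ (Set.Ioo 0 1)) (hpos : ∀ t ∈ Set.Ioo (0 : ℝ) 1, 0 < φ t) (a : ℝ) :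
    ∃ p₁ p₂ : ℝ, 0 < p₁ ∧ p₁ < p₂ ∧
      ∑' j : ℕ, (a + 2 * (j : ℝ)) * sinCoeff φ j * p₁ ^ j < 0 ∧
      0 < ∑' j : ℕ, (a + 2 * (j : ℝ)) * sinCoeff φ j * p₂ ^ j := by
  have hπ := Real.pi_pos
  set h : ℝ → ℝ := fun x => x ^ (a - 1) * ∑' j : ℕ, sinCoeff φ j * x ^ (2 * j + 1) with hh
  have hd : ∀ z, 0 < z → HasDerivAt h _ z := fun z hz =>
    hasDerivAt_rpow_mul_tsum_sinCoeff hint hpos a hz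
  have hval : ∀ z, h z = z ^ (a - 1) * ∫ t in (0 : ℝ)..1, φ t * Real.sin (z * t) := fun z => by
    rw [hh, ← (hasSum_sinCoeff hint z).tsum_eq]
  have h1 : 0 < h Real.pi := by
    rw [hval]
    exact mul_pos (Real.rpow_pos_of_pos hπ _) (integral_mul_sin_pi_pos hint hpos)
  have h2 : h (2 * Real.pi) < 0 := by
    rw [hval]
    exact mul_neg_of_pos_of_neg (Real.rpow_pos_of_pos (by positivity) _)
      (integral_mul_sin_two_pi_neg hint hmono)
  have h3 : 0 < h (3 * Real.pi) := by
    rw [hval]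
    exact mul_pos (Real.rpow_pos_of_pos (by positivity) _)
      (integral_mul_sin_three_pi_pos hint hmono hpos)
  obtain ⟨x, hx, hxe⟩ := exists_hasDerivAt_eq_slope h _ (show Real.pi < 2 * Real.pi by linarith)
    (fun x hx => (hd x (by linarith [hx.1])).continuousAt.continuousWithinAt)
    (fun x hx => hd x (by linarith [hx.1]))
  obtain ⟨y, hy, hye⟩ := exists_hasDerivAt_eq_slope h _
    (show 2 * Real.pi < 3 * Real.pi by linarith)
    (fun x hx => (hd x (by linarith [hx.1])).continuousAt.continuousWithinAt)
    (fun x hx => hd x (by linarith [hx.1]))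
  have hx0 : 0 < x := by linarith [hx.1]
  have hy0 : 0 < y := by linarith [hy.1]
  refine ⟨x ^ 2, y ^ 2, by positivity, by nlinarith [hx.2, hy.1], ?_, ?_⟩
  · have : (h (2 * Real.pi) - h Real.pi) / (2 * Real.pi - Real.pi) < 0 :=
      div_neg_of_neg_of_pos (by linarith) (by linarith)
    rw [← hxe] at this
    exact neg_of_mul_neg_right this (Real.rpow_pos_of_pos hx0 _).le
  · have : 0 < (h (3 * Real.pi) - h (2 * Real.pi)) / (3 * Real.pi - 2 * Real.pi) :=
      div_pos (by linarith) (by linarith)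
    rw [← hye] at this
    exact pos_of_mul_pos_right this (Real.rpow_pos_of_pos hy0 _).le

/-- Strict Euler-Rayleigh bounds for the least positive zero of `∑ c_j x ^ j`, the normalized
`∑ (a + 2 j) sinCoeff φ j x ^ j`. The three expressions in `c 1, c 2, c 3` are the sums of the first,
second and third powers of the reciprocal zeros. -/
theorem exists_isLeast_zero_euler_rayleigh (hint : IntervalIntegrable φ volume 0 1)
    (hmono : StrictMonoOn φ (Set.Ioo 0 1)) (hpos : ∀ t ∈ Set.Ioo (0 : ℝ) 1, 0 < φ t)
    {a : ℝ} (ha : 0 < a) {c : ℕ → ℝ}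
    (hc : ∀ j : ℕ, c j = (a + 2 * (j : ℝ)) * sinCoeff φ j / (a * sinCoeff φ 0)) :
    ∃ x₀, IsLeast {x : ℝ | 0 < x ∧ ∑' j, c j * x ^ j = 0} x₀ ∧
      x₀⁻¹ < -c 1 ∧ x₀⁻¹ ^ 2 < c 1 ^ 2 - 2 * c 2 ∧
      x₀⁻¹ ^ 3 < -c 1 ^ 3 + 3 * c 1 * c 2 - 3 * c 3 ∧
      c 1 ^ 2 - 2 * c 2 < x₀⁻¹ * -c 1 ∧
      -c 1 ^ 3 + 3 * c 1 * c 2 - 3 * c 3 < x₀⁻¹ * (c 1 ^ 2 - 2 * c 2) := by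
  obtain ⟨Y, K, hY, hlim, hdom⟩ := exists_prodOneSub_tendsto hint hmono.monotoneOn hpos ha
  simp only [← hc] at hlim
  have hB := summable_div_factorial_mul_pow K
  have hcB : ∀ j : ℕ, |c j| ≤ K / (j.factorial : ℝ) := fun j =>
    le_of_tendsto (hlim j).abs (hdom.mono fun n hn => hn j)
  have hd0 := sinCoeff_zero_pos hint hpos
  have hc0 : 0 < c 0 := by
    rw [hc]; simp only [Nat.cast_zero, mul_zero, add_zero]; positivity
  obtain ⟨p₁, p₂, hp₁, hp, hf₁, hf₂⟩ := exists_sign_change hint hmono hpos a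
  have hf : ∀ x, ∑' j, c j * x ^ j
      = (a * sinCoeff φ 0)⁻¹ * ∑' j : ℕ, (a + 2 * (j : ℝ)) * sinCoeff φ j * x ^ j := by
    intro x
    rw [← tsum_mul_left]
    refine tsum_congr fun j => ?_
    rw [hc]; ring
  have hinv : 0 < (a * sinCoeff φ 0)⁻¹ := by positivity
  replace hf₁ : ∑' j, c j * p₁ ^ j < 0 := by
    rw [hf]; exact mul_neg_of_pos_of_neg hinv hf₁
  replace hf₂ : 0 < ∑' j, c j * p₂ ^ j := by
    rw [hf]; exact mul_pos hinv hf₂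
  obtain ⟨x₀, hx₀p, hx₀⟩ := exists_isLeast_zero_tsum hcB hB hc0 hp₁ hf₁
  have hs1 : Tendsto (fun n => powerSum (Y n) 1) atTop (𝓝 (-c 1)) := by
    simpa only [powerSum_one] using (hlim 1).neg
  have hs2 : Tendsto (fun n => powerSum (Y n) 2) atTop (𝓝 (c 1 ^ 2 - 2 * c 2)) := by
    simpa only [powerSum_two] using ((hlim 1).pow 2).sub ((hlim 2).const_mul 2)
  have hs3 : Tendsto (fun n => powerSum (Y n) 3) atTop
      (𝓝 (-c 1 ^ 3 + 3 * c 1 * c 2 - 3 * c 3)) := by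
    simpa only [powerSum_three] using
      (((hlim 1).pow 3).neg.add (((hlim 1).const_mul 3).mul (hlim 2))).sub ((hlim 3).const_mul 3)
  have lower := fun {k : ℕ} {s : ℝ} => inv_pow_lt_of_tendsto_powerSum (k := k) (s := s) hY hlim hdom
    hB hx₀.1.1 hx₀.1.2 hx₀p hp hf₁ hf₂
  have upper := fun {k : ℕ} {s t : ℝ} => lt_inv_mul_of_tendsto_powerSum (k := k) (s := s) (t := t)
    hY hlim hdom hB hc0 hx₀ hx₀p hp hf₁ hf₂
  refine ⟨x₀, hx₀, ?_, lower hs2, lower hs3, upper hs1 hs2, upper hs2 hs3⟩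
  simpa using lower hs1

end Weight

/-! ### The Struve function as a sine transform -/

/-- The weight `(1 - t ^ 2) ^ (ν - 1/2)` of the Poisson integral of the Struve function. -/
noncomputable def struveWeight (ν t : ℝ) : ℝ := (1 - t ^ 2) ^ (ν - 1 / 2)

theorem struveWeight_pos (ν : ℝ) {t : ℝ} (ht : t ∈ Set.Ioo (0 : ℝ) 1) : 0 < struveWeight ν t :=
  Real.rpow_pos_of_pos (by nlinarith [ht.1, ht.2]) _

theorem strictMonoOn_struveWeight {ν : ℝ} (hν : ν < 1 / 2) :
    StrictMonoOn (struveWeight ν) (Set.Ioo 0 1) := by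
  intro s hs t ht hst
  exact Real.rpow_lt_rpow_of_neg (by nlinarith [ht.1, ht.2]) (by nlinarith [hs.1]) (by linarith)

theorem intervalIntegrable_struveWeight {ν : ℝ} (h₁ : -(1 / 2) < ν) :
    IntervalIntegrable (struveWeight ν) volume 0 1 := by
  have h : IntervalIntegrable (fun t : ℝ => (1 - t) ^ (ν - 1 / 2)) volume 0 1 := by
    have := (intervalIntegral.intervalIntegrable_rpow' (a := 0) (b := 1)
      (show -1 < ν - 1 / 2 by linarith)).comp_sub_left 1
    simpa using this.symm
  rw [← intervalIntegrable_congr_uIoo (f := fun t : ℝ =>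
    (1 - t) ^ (ν - 1 / 2) * (1 + t) ^ (ν - 1 / 2))]
  · refine h.mul_continuousOn (ContinuousOn.rpow_const (by fun_prop) fun t ht => Or.inl ?_)
    rw [Set.uIcc_of_le zero_le_one] at ht
    linarith [ht.1]
  · intro t ht
    rw [Set.uIoo_of_le zero_le_one] at ht
    simp only [struveWeight]
    rw [← Real.mul_rpow (by linarith [ht.2]) (by linarith [ht.1])]
    ring_nf

/-- Integration by parts: the derivative of `t ^ (2 j + 2) * (1 - t ^ 2) ^ (ν + 1/2)` integrates to
zero. -/
theorem integral_struveWeight_succ {ν : ℝ} (h₁ : -(1 / 2) < ν) (j : ℕ) :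
    (2 * (j : ℝ) + 2 * ν + 3) * ∫ t in (0 : ℝ)..1, struveWeight ν t * t ^ (2 * (j + 1) + 1)
      = (2 * (j : ℝ) + 2) * ∫ t in (0 : ℝ)..1, struveWeight ν t * t ^ (2 * j + 1) := by
  have hint := intervalIntegrable_struveWeight h₁
  have hi : ∀ m : ℕ, IntervalIntegrable (fun t => struveWeight ν t * t ^ m) volume 0 1 :=
    fun m => hint.mul_continuousOn (by fun_prop)
  have hFTC := intervalIntegral.integral_eq_sub_of_hasDerivAt_of_le (a := 0) (b := 1)
    (f := fun t : ℝ => t ^ (2 * j + 2) * (1 - t ^ 2) ^ (ν + 1 / 2))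
    (f' := fun t : ℝ => (2 * (j : ℝ) + 2) * (struveWeight ν t * t ^ (2 * j + 1))
      - (2 * (j : ℝ) + 2 * ν + 3) * (struveWeight ν t * t ^ (2 * (j + 1) + 1))) zero_le_one
    (by
      refine ContinuousOn.mul (by fun_prop) (ContinuousOn.rpow_const (by fun_prop) fun t _ => ?_)
      exact Or.inr (by linarith))
    (fun t ht => by
      have hpos : 0 < 1 - t ^ 2 := by nlinarith [ht.1, ht.2]
      have hd : HasDerivAt (fun t : ℝ => 1 - t ^ 2) (-(2 * t)) t := by
        simpa using (hasDerivAt_pow 2 t).const_sub 1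
      have h := (hasDerivAt_pow (2 * j + 2) t).mul
        (hd.rpow_const (p := ν + 1 / 2) (Or.inl hpos.ne'))
      refine h.congr_deriv ?_
      have e1 : (1 - t ^ 2) ^ (ν + 1 / 2) = (1 - t ^ 2) ^ (ν - 1 / 2) * (1 - t ^ 2) := by
        rw [← Real.rpow_add_one hpos.ne']; ring_nf
      rw [e1, show ν + 1 / 2 - 1 = ν - 1 / 2 by ring, struveWeight,
        show 2 * j + 2 - 1 = 2 * j + 1 by omega]
      push_cast
      ring)
    (((hi _).const_mul _).sub ((hi _).const_mul _))
  rw [intervalIntegral.integral_sub ((hi _).const_mul _) ((hi _).const_mul _),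
    intervalIntegral.integral_const_mul, intervalIntegral.integral_const_mul] at hFTC
  rw [show (1 : ℝ) - 1 ^ 2 = 0 by norm_num, Real.zero_rpow (by linarith)] at hFTC
  simp at hFTC
  linarith

theorem sinCoeff_struveWeight_succ {ν : ℝ} (h₁ : -(1 / 2) < ν) (j : ℕ) :
    sinCoeff (struveWeight ν) (j + 1)
      = -sinCoeff (struveWeight ν) j / ((2 * (j : ℝ) + 3) * (2 * (j : ℝ) + 2 * ν + 3)) := by
  have hj : (0 : ℝ) ≤ j := j.cast_nonneg
  have h3 : 2 * (j : ℝ) + 2 * ν + 3 ≠ 0 := by linarith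
  have h : ∫ t in (0 : ℝ)..1, struveWeight ν t * t ^ (2 * (j + 1) + 1) = (2 * (j : ℝ) + 2)
      * (∫ t in (0 : ℝ)..1, struveWeight ν t * t ^ (2 * j + 1)) / (2 * (j : ℝ) + 2 * ν + 3) := by
    rw [eq_div_iff h3, ← integral_struveWeight_succ h₁ j, mul_comm]
  rw [sinCoeff, sinCoeff, h, show 2 * (j + 1) + 1 = (2 * j + 1 + 1) + 1 by ring,
    Nat.factorial_succ (2 * j + 1 + 1), Nat.factorial_succ (2 * j + 1)]
  push_cast
  have h4 : ((2 * j + 1).factorial : ℝ) ≠ 0 := by positivity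
  field_simp
  ring

/-- The coefficients of the Struve function in powers of `z / 2`. -/
noncomputable def struveCoeff (ν : ℝ) (n : ℕ) : ℝ :=
  (-1) ^ n / (Real.Gamma ((n : ℝ) + 3 / 2) * Real.Gamma ((n : ℝ) + ν + 3 / 2))

theorem struveCoeff_zero_pos {ν : ℝ} (h₁ : -(1 / 2) < ν) : 0 < struveCoeff ν 0 := by
  have h2 : 0 < Real.Gamma (((0 : ℕ) : ℝ) + 3 / 2) := Real.Gamma_pos_of_pos (by norm_num)
  have h3 : 0 < Real.Gamma (((0 : ℕ) : ℝ) + ν + 3 / 2) :=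
    Real.Gamma_pos_of_pos (by push_cast; linarith)
  rw [struveCoeff, pow_zero]
  positivity

theorem struveCoeff_eq {ν : ℝ} (h₁ : -(1 / 2) < ν) (n : ℕ) :
    struveCoeff ν n = struveCoeff ν 0 / sinCoeff (struveWeight ν) 0
      * (sinCoeff (struveWeight ν) n * 4 ^ n) := by
  have hd0 := sinCoeff_zero_pos (intervalIntegrable_struveWeight h₁)
    (fun t ht => struveWeight_pos ν ht)
  induction n with
  | zero => rw [pow_zero, mul_one, div_mul_cancel₀ _ hd0.ne']
  | succ n ih =>
    have hn : (0 : ℝ) ≤ n := n.cast_nonneg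
    have e : struveCoeff ν (n + 1)
        = -struveCoeff ν n / (((n : ℝ) + 3 / 2) * ((n : ℝ) + ν + 3 / 2)) := by
      have g1 : Real.Gamma (((n + 1 : ℕ) : ℝ) + 3 / 2)
          = ((n : ℝ) + 3 / 2) * Real.Gamma ((n : ℝ) + 3 / 2) := by
        rw [← Real.Gamma_add_one (by linarith)]; push_cast; ring_nf
      have g2 : Real.Gamma (((n + 1 : ℕ) : ℝ) + ν + 3 / 2)
          = ((n : ℝ) + ν + 3 / 2) * Real.Gamma ((n : ℝ) + ν + 3 / 2) := by
        rw [← Real.Gamma_add_one (by linarith)]; push_cast; ring_nf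
      have p1 : Real.Gamma ((n : ℝ) + 3 / 2) ≠ 0 := (Real.Gamma_pos_of_pos (by linarith)).ne'
      have p2 : Real.Gamma ((n : ℝ) + ν + 3 / 2) ≠ 0 := (Real.Gamma_pos_of_pos (by linarith)).ne'
      have p3 : (n : ℝ) + ν + 3 / 2 ≠ 0 := by linarith
      rw [struveCoeff, struveCoeff, g1, g2]
      field_simp
      ring
    have q1 : (n : ℝ) + ν + 3 / 2 ≠ 0 := by linarith
    have q2 : 2 * (n : ℝ) + 2 * ν + 3 ≠ 0 := by linarith
    rw [e, ih, sinCoeff_struveWeight_succ h₁ n]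
    have q3 : (n : ℝ) + ν + 3 / 2 = (2 * (n : ℝ) + 2 * ν + 3) / 2 := by ring
    have q4 : (n : ℝ) + 3 / 2 = (2 * (n : ℝ) + 3) / 2 := by ring
    rw [q3, q4]
    field_simp
    ring

theorem cpow_two_mul_add_one_add {z : ℂ} (hz : z ≠ 0) (n : ℕ) (ν : ℂ) :
    z ^ (2 * (n : ℂ) + ν + 1) = (z ^ 2) ^ n * z ^ (ν + 1) := by
  rw [← pow_mul, ← Complex.cpow_natCast z (2 * n), ← Complex.cpow_add _ _ hz]
  push_cast
  ring_nf

theorem hasSum_struveComb {ν : ℝ} (h₁ : -(1 / 2) < ν) (α : ℝ) {x : ℝ}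
    (hx : 0 < x) :
    HasSum (fun n : ℕ => ((α + ν + 1 + 2 * (n : ℝ) : ℝ) : ℂ) *
      ((struveCoeff ν n : ℂ) * ((x : ℂ) / 2) ^ (2 * (n : ℂ) + ν + 1))) (struveComb α ν x) := by
  set F : ℕ → ℂ → ℂ := fun n z => (struveCoeff ν n : ℂ) * (z / 2) ^ (2 * (n : ℂ) + ν + 1) with hF
  set U : Set ℂ := {z : ℂ | 0 < z.re} ∩ Metric.ball 0 (x + 1) with hU
  have hUo : IsOpen U := (isOpen_lt continuous_const Complex.continuous_re).inter Metric.isOpen_ball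
  have hxU : (x : ℂ) ∈ U := by
    refine ⟨by simpa using hx, ?_⟩
    rw [mem_ball_zero_iff, Complex.norm_real, Real.norm_of_nonneg hx.le]
    linarith
  have hint := intervalIntegrable_struveWeight h₁
  have hpos : ∀ t ∈ Set.Ioo (0 : ℝ) 1, 0 < struveWeight ν t := fun t ht => struveWeight_pos ν ht
  set I := ∫ t in (0 : ℝ)..1, struveWeight ν t
  have hI : 0 ≤ I := (integral_weight_pos hint hpos).le
  set κ := struveCoeff ν 0 / sinCoeff (struveWeight ν) 0
  have hslit : ∀ z ∈ U, z / 2 ∈ Complex.slitPlane := fun z hz => Or.inl (by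
    have : 0 < z.re := hz.1
    simpa using this)
  have hder : ∀ n, ∀ z ∈ U, HasDerivAt (F n)
      ((struveCoeff ν n : ℂ) * ((2 * (n : ℂ) + ν + 1) * (z / 2) ^ (2 * (n : ℂ) + ν + 1 - 1)
        * (1 / 2))) z := fun n z hz =>
    (((hasDerivAt_id z).div_const 2).cpow_const (hslit z hz)).const_mul _
  have hbound : ∀ n, ∀ z ∈ U, ‖F n z‖
      ≤ |κ| * ((1 + 1) * I / (n.factorial : ℝ) * ((x + 1) ^ 2) ^ n * ((x + 1) / 2) ^ (ν + 1)) := by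
    intro n z hz
    have hz2 : z / 2 ≠ 0 := Complex.slitPlane_ne_zero (hslit z hz)
    have hzn : ‖z‖ < x + 1 := mem_ball_zero_iff.1 hz.2
    have e1 : ‖(z / 2) ^ ((ν : ℂ) + 1)‖ ≤ ((x + 1) / 2) ^ (ν + 1) := by
      rw [show (ν : ℂ) + 1 = ((ν + 1 : ℝ) : ℂ) by push_cast; ring, Complex.norm_cpow_real]
      refine Real.rpow_le_rpow (norm_nonneg _) ?_ (by linarith)
      rw [norm_div, Complex.norm_ofNat]
      linarith
    have e2 : |sinCoeff (struveWeight ν) n| ≤ (1 + 1) * I / (n.factorial : ℝ) := by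
      refine le_trans ?_ (add_mul_div_factorial_le one_pos hI n)
      have h := abs_sinCoeff_le hint hpos n
      have h0 : 0 ≤ I / ((2 * n + 1).factorial : ℝ) := by positivity
      nlinarith [mul_nonneg (Nat.cast_nonneg (α := ℝ) n) h0]
    have e3 : 4 ^ n * ‖(z / 2) ^ 2‖ ^ n ≤ ((x + 1) ^ 2) ^ n := by
      rw [← mul_pow, norm_pow, norm_div, Complex.norm_ofNat]
      refine pow_le_pow_left₀ (by positivity) ?_ n
      have := pow_le_pow_left₀ (norm_nonneg z) hzn.le 2
      linarith
    simp only [hF]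
    rw [cpow_two_mul_add_one_add hz2, norm_mul, norm_mul, norm_pow, Complex.norm_real,
      Real.norm_eq_abs, struveCoeff_eq h₁, abs_mul, abs_mul, abs_of_pos (show (0 : ℝ) < 4 ^ n by positivity)]
    calc |κ| * (|sinCoeff (struveWeight ν) n| * 4 ^ n) * (‖(z / 2) ^ 2‖ ^ n * ‖(z / 2) ^ ((ν : ℂ) + 1)‖)
        = |κ| * (|sinCoeff (struveWeight ν) n| * (4 ^ n * ‖(z / 2) ^ 2‖ ^ n)
          * ‖(z / 2) ^ ((ν : ℂ) + 1)‖) := by ring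
      _ ≤ _ := by gcongr
  have hsum : Summable fun n : ℕ =>
      |κ| * ((1 + 1) * I / (n.factorial : ℝ) * ((x + 1) ^ 2) ^ n * ((x + 1) / 2) ^ (ν + 1)) :=
    ((summable_div_factorial_mul_pow _ _).mul_right _).mul_left _
  have hS : struveH (ν : ℂ) = fun z => ∑' n, F n z := by
    funext z
    refine tsum_congr fun n => ?_
    simp only [hF, struveCoeff]
    push_cast [← Complex.Gamma_ofReal]
    rfl
  have hderiv := Complex.hasSum_deriv_of_summable_norm hsum
    (fun n z hz => (hder n z hz).differentiableAt.differentiableWithinAt) hUo hbound hxU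
  have hval : HasSum (fun n => F n x) (∑' n, F n x) :=
    (Summable.of_norm_bounded hsum fun n => hbound n x hxU).hasSum
  have h := (hval.mul_left (α : ℂ)).add (hderiv.mul_left (x : ℂ))
  rw [struveComb, hS]
  refine h.congr_fun fun n => ?_
  have hx2 : (x : ℂ) / 2 ≠ 0 := Complex.slitPlane_ne_zero (hslit x hxU)
  rw [(hder n x hxU).deriv, Complex.cpow_sub _ _ hx2, Complex.cpow_one]
  simp only [hF]
  have hx0 : (x : ℂ) ≠ 0 := by exact_mod_cast hx.ne'
  push_cast
  field_simp
  ring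

/-- On the positive axis `struveComb` is a nonvanishing factor times a power series in `x ^ 2`. -/
theorem struveComb_eq_zero_iff {α ν : ℝ} (hαν : -1 < α + ν) (h₁ : -(1 / 2) < ν)
    {c : ℕ → ℝ} (hc : ∀ j : ℕ, c j = (α + ν + 1 + 2 * (j : ℝ)) * sinCoeff (struveWeight ν) j
      / ((α + ν + 1) * sinCoeff (struveWeight ν) 0)) {x : ℝ} (hx : 0 < x) :
    struveComb (α : ℂ) (ν : ℂ) (x : ℂ) = 0 ↔ ∑' j, c j * (x ^ 2) ^ j = 0 := by
  have hd0 := sinCoeff_zero_pos (intervalIntegrable_struveWeight h₁)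
    (fun t ht => struveWeight_pos ν ht)
  have hA0 := struveCoeff_zero_pos h₁
  have ha : 0 < α + ν + 1 := by linarith
  set C : ℝ := (α + ν + 1) * struveCoeff ν 0 * (x / 2) ^ (ν + 1) with hC
  have hCpos : 0 < C := mul_pos (mul_pos ha hA0) (Real.rpow_pos_of_pos (by positivity) _)
  have h : struveComb (α : ℂ) (ν : ℂ) (x : ℂ) = ((C * ∑' j, c j * (x ^ 2) ^ j : ℝ) : ℂ) := by
    rw [← (hasSum_struveComb h₁ α hx).tsum_eq, ← tsum_mul_left, Complex.ofReal_tsum]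
    refine tsum_congr fun n => ?_
    have hx2 : (x : ℂ) / 2 ≠ 0 := by
      have : (x : ℂ) ≠ 0 := by exact_mod_cast hx.ne'
      simpa using this
    have e1 : ((x : ℂ) / 2) ^ ((ν : ℂ) + 1) = (((x / 2) ^ (ν + 1) : ℝ) : ℂ) := by
      rw [Complex.ofReal_cpow (by positivity)]
      push_cast
      rfl
    have e2 : (((x : ℂ) / 2) ^ 2) ^ n = (((x / 2) ^ 2) ^ n : ℝ) := by push_cast; rfl
    rw [cpow_two_mul_add_one_add hx2, e1, e2, ← Complex.ofReal_mul, ← Complex.ofReal_mul,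
      ← Complex.ofReal_mul]
    congr 1
    rw [struveCoeff_eq h₁, hc, hC]
    have e3 : ((x / 2) ^ 2) ^ n = (x ^ 2) ^ n / 4 ^ n := by
      rw [← div_pow]; congr 1; ring
    rw [e3]
    field_simp
  rw [h]
  norm_cast
  rw [mul_eq_zero]
  exact or_iff_right hCpos.ne'

end

/-! ### Bounds for the least positive zero -/

theorem theorem1 (α ν : ℝ) (hαν : -1 < α + ν) (hν : |ν| < 1 / 2) :
    0 < kappaOne α ν ∧ 0 < kappaTwo α ν ∧
    ∃ ζ : ℝ, IsLeast {x : ℝ | 0 < x ∧ struveComb (α : ℂ) (ν : ℂ) (x : ℂ) = 0} ζ ∧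
      3 * (2 * ν + 3) * (α + ν + 1) / (α + ν + 3) < ζ ^ 2 ∧
      3 * (2 * ν + 3) * (α + ν + 1) * Real.sqrt (5 * (2 * ν + 5)) / Real.sqrt (kappaOne α ν)
        < ζ ^ 2 ∧
      3 * (2 * ν + 3) * (α + ν + 1) * (35 * (2 * ν + 5) * (2 * ν + 7)) ^ (1 / 3 : ℝ)
        / (kappaTwo α ν) ^ (1 / 3 : ℝ) < ζ ^ 2 ∧
      ζ ^ 2 < 15 * (2 * ν + 3) * (2 * ν + 5) * (α + ν + 1) * (α + ν + 3) / kappaOne α ν ∧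
      ζ ^ 2 < 21 * (2 * ν + 3) * (2 * ν + 7) * (α + ν + 1) * kappaOne α ν / kappaTwo α ν := by
  obtain ⟨hν₁, hν₂⟩ := abs_lt.1 hν
  have ha : 0 < α + ν + 1 := by linarith
  have hb : 0 < 2 * ν + 3 := by linarith
  have hb' : 0 < 2 * ν + 5 := by linarith
  have hb'' : 0 < 2 * ν + 7 := by linarith
  have hint := intervalIntegrable_struveWeight hν₁
  have hpos : ∀ t ∈ Set.Ioo (0 : ℝ) 1, 0 < struveWeight ν t := fun t ht => struveWeight_pos ν ht
  have hd0 := (sinCoeff_zero_pos hint hpos).ne'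
  set c : ℕ → ℝ := fun j => (α + ν + 1 + 2 * (j : ℝ)) * sinCoeff (struveWeight ν) j
    / ((α + ν + 1) * sinCoeff (struveWeight ν) 0) with hc
  obtain ⟨x₀, hx₀, h1, h2, h3, h4, h5⟩ := exists_isLeast_zero_euler_rayleigh hint
    (strictMonoOn_struveWeight hν₂) hpos ha (c := c) fun _ => rfl
  have hx₀pos : 0 < x₀ := hx₀.1.1
  have hd1 := sinCoeff_struveWeight_succ hν₁ 0
  have hd2 := sinCoeff_struveWeight_succ hν₁ 1
  have hd3 := sinCoeff_struveWeight_succ hν₁ 2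
  simp only [zero_add, Nat.reduceAdd, Nat.cast_zero, Nat.cast_one, Nat.cast_ofNat] at hd1 hd2 hd3
  have r1 : 2 * 0 + 2 * ν + 3 = 2 * ν + 3 := by ring
  have r2 : 2 * 1 + 2 * ν + 3 = 2 * ν + 5 := by ring
  have r3 : 2 * 2 + 2 * ν + 3 = 2 * ν + 7 := by ring
  rw [r1] at hd1
  rw [r2, hd1] at hd2
  rw [r3, hd2] at hd3
  have hc1 : c 1 = -((α + ν + 3) / ((α + ν + 1) * (3 * (2 * ν + 3)))) := by
    simp only [hc, hd1]
    push_cast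
    field_simp
    ring
  have hc2 : c 2 = (α + ν + 5) / ((α + ν + 1) * (15 * (2 * ν + 3) * (2 * ν + 5))) := by
    simp only [hc, hd2]
    push_cast
    field_simp
    ring
  have hc3 : c 3
      = -((α + ν + 7) / ((α + ν + 1) * (105 * (2 * ν + 3) * (2 * ν + 5) * (2 * ν + 7)))) := by
    simp only [hc, hd3]
    push_cast
    field_simp
    ring
  set D := 3 * (2 * ν + 3) * (α + ν + 1) with hD
  have hDpos : 0 < D := by positivity
  -- `field_simp` meets the factors of the denominators in this form.
  have g3 : ν * 2 + 3 ≠ 0 := by linarith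
  have g5 : ν * 2 + 5 ≠ 0 := by linarith
  have g7 : ν * 2 + 7 ≠ 0 := by linarith
  have s1 : -c 1 = (α + ν + 3) / D := by rw [hc1, hD]; field_simp
  have s2 : c 1 ^ 2 - 2 * c 2 = kappaOne α ν / (D ^ 2 * (5 * (2 * ν + 5))) := by
    rw [hc1, hc2, hD, kappaOne]
    field_simp
    ring
  have s3 : -c 1 ^ 3 + 3 * c 1 * c 2 - 3 * c 3
      = kappaTwo α ν / (D ^ 3 * (35 * (2 * ν + 5) * (2 * ν + 7))) := by
    rw [hc1, hc2, hc3, hD, kappaTwo]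
    field_simp
    ring
  rw [s1] at h1
  rw [s2] at h2
  rw [s3] at h3
  rw [s1, s2] at h4
  rw [s2, s3] at h5
  have hκ₁ : 0 < kappaOne α ν := by
    by_contra! h
    have h6 := div_nonpos_of_nonpos_of_nonneg h
      (show 0 ≤ D ^ 2 * (5 * (2 * ν + 5)) by positivity)
    have h7 : 0 < x₀⁻¹ ^ 2 := by positivity
    linarith
  have hκ₂ : 0 < kappaTwo α ν := by
    by_contra! h
    have h6 := div_nonpos_of_nonpos_of_nonneg h
      (show 0 ≤ D ^ 3 * (35 * (2 * ν + 5) * (2 * ν + 7)) by positivity)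
    have h7 : 0 < x₀⁻¹ ^ 3 := by positivity
    linarith
  have hα3 : 0 < α + ν + 3 := by linarith
  refine ⟨hκ₁, hκ₂, Real.sqrt x₀, ⟨⟨Real.sqrt_pos.2 hx₀pos, ?_⟩, ?_⟩, ?_⟩
  · rw [struveComb_eq_zero_iff hαν hν₁ (c := c) (fun _ => rfl) (Real.sqrt_pos.2 hx₀pos),
      Real.sq_sqrt hx₀pos.le]
    exact hx₀.1.2
  · rintro x ⟨hx, hx0⟩
    rw [struveComb_eq_zero_iff hαν hν₁ (c := c) (fun _ => rfl) hx] at hx0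
    exact (Real.sqrt_le_left hx.le).2 (hx₀.2 ⟨by positivity, hx0⟩)
  rw [Real.sq_sqrt hx₀pos.le]
  refine ⟨?_, ?_, ?_, ?_, ?_⟩
  · have h := inv_lt_of_inv_lt₀ hx₀pos h1
    rwa [inv_div] at h
  · refine lt_of_pow_lt_pow_left₀ 2 hx₀pos.le ?_
    rw [inv_pow] at h2
    have h := inv_lt_of_inv_lt₀ (pow_pos hx₀pos 2) h2
    rwa [div_pow, mul_pow, Real.sq_sqrt (by positivity), Real.sq_sqrt hκ₁.le, ← inv_div]
  · refine lt_of_pow_lt_pow_left₀ 3 hx₀pos.le ?_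
    rw [inv_pow] at h3
    have h := inv_lt_of_inv_lt₀ (pow_pos hx₀pos 3) h3
    have hcube : ∀ y : ℝ, 0 ≤ y → (y ^ (1 / 3 : ℝ)) ^ 3 = y := fun y hy => by
      rw [← Real.rpow_natCast, ← Real.rpow_mul hy]; norm_num
    rwa [div_pow, mul_pow, hcube _ (by positivity), hcube _ hκ₂.le, ← inv_div]
  · rw [inv_mul_eq_div, div_div, div_lt_div_iff₀ (by positivity) (by positivity)] at h4
    rw [lt_div_iff₀ hκ₁]
    refine lt_of_mul_lt_mul_right ?_ hDpos.le
    have e : 15 * (2 * ν + 3) * (2 * ν + 5) * (α + ν + 1) * (α + ν + 3)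
        = D * (5 * (2 * ν + 5)) * (α + ν + 3) := by rw [hD]; ring
    rw [e]
    linarith
  · rw [inv_mul_eq_div, div_div, div_lt_div_iff₀ (by positivity) (by positivity)] at h5
    rw [lt_div_iff₀ hκ₂]
    refine lt_of_mul_lt_mul_right ?_ (show 0 ≤ D ^ 2 * (5 * (2 * ν + 5)) by positivity)
    have e : 21 * (2 * ν + 3) * (2 * ν + 7) * (α + ν + 1) * kappaOne α ν
        = D * (7 * (2 * ν + 7)) * kappaOne α ν := by rw [hD]; ring
    rw [e]
    linarith
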